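/- Let $X_1,\dots,X_d$ be vectors in a quasilattice $Q\subset\mathbb R^3$ (the $\mathbb Z$-span of finitely many $\mathbb R$-spanning vectors), let $\lambda_1,\dots,\lambda_d\in\mathbb R$, and let $\Delta=\bigcap_j\{\mu\in(\mathbb R^3)^*\mid\langle\mu,X_j\rangle\ge\lambda_j\}$. Let $\pi:\mathbb R^d\to\mathbb R^3$, $e_j\mapsto X_j$, let $\pi_{\mathbb C}:\mathbb C^d\to\mathbb C^3$ be its complexification, and let $N$ and $N_{\mathbb C}$ be the kernels of the induced homomorphisms $\mathbb R^d/\mathbb Z^d\to\mathbb R^3/Q$ and $\mathbb C^d/\mathbb Z^d\to\mathbb C^3/Q$. The groups $\mathbb R^d/\mathbb Z^d$ and $\mathbb C^d/\mathbb Z^d$ are identified with $(S^1)^d$ and $(\mathbb C^*)^d$ by $\theta\mapsto(e^{2\pi i\theta_j})_j$ and act diagonally on $\mathbb C^d$. Put $\omega_0=\frac1{2\pi i}\sum_j dz_j\wedge d\bar z_j$ and $J(z)=\sum_j(|z_j|^2+\lambda_j)e_j^*$, and let $\Psi(z)$ be the restriction of $J(z)$ to $\ker\pi$. The symplectic quotient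 is $M_\Delta=\Psi^{-1}(0)/N$, with the symplectic structure induced by $\omega_0$, the induced action of $\mathbb R^d/\mathbb Z^d$ (through $\mathbb R^3/Q$) and the moment map $\Phi:M_\Delta\to(\mathbb R^3)^*$ given by $\langle\Phi([z]),X_j\rangle=|z_j|^2+\lambda_j$. The complex quotient is $X_\Delta=\mathbb C^d_\Delta/N_{\mathbb C}$, where $\mathbb C^d_\Delta=\bigcup_F\{z\mid z_j\ne0\text{ if }j\notin I_F\}$, $F$ runs over the open faces of $\Delta$, and $I_F=\{j\mid\langle\mu,X_j\rangle=\lambda_j \text{ for }\mu\in F\}$. Say that Delzant's condition holds if $\Delta$ is a simple $3$-dimensional convex polytope with exactly $d$ facets, given by the equations $\langle\mu,X_j\rangle=\lambda_j$, and for each vertex the normals $X_j$ of the facets through it are a basis of $\mathbb R^3$ that generates $Q$ over $\mathbb Z$. (1) Regular tetrahedron. Let $Y_1=(1,1,1)$, $Y_2=(1,-1,-1)$, $Y_3=(-1,1,-1)$, $Y_4=(-1,-1,1)$, let $L\subset\mathbb Z^3$ be the lattice they generate, and take $Q=L$, $X_j=Y_j$, $\lambda_j=-1$. Then $\Delta$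 is the convex hull of the points $(1,1,1)$, $(1,-1,-1)$, $(-1,1,-1)$, $(-1,-1,1)$, Delzant's condition holds, and: - $N=\{(s,s,s,s)\mid s\in S^1\}\cong S^1$, as topological groups; - $\Psi^{-1}(0)=\{z\in\mathbb C^4\mid\sum_j|z_j|^2=4\}$ is the sphere $S^7$ of radius $2$, and the identity of $S^7$ induces a symplectomorphism $M_\Delta=S^7/S^1$, where $S^1$ acts diagonally and the form is induced by $\omega_0$; - $N_{\mathbb C}=\{(s,s,s,s)\mid s\in\mathbb C^*\}\cong\mathbb C^*$, as topological groups, $\mathbb C^4_\Delta=\mathbb C^4\smallsetminus\{0\}$, and $[z]\mapsto[z_1:z_2:z_3:z_4]$ is a biholomorphism $X_\Delta=(\mathbb C^4\smallsetminus\{0\})/\mathbb C^*\to\mathbb{CP}^3$. (2) Cube. Let $a>0$ and take $Q=\mathbb Z^3$, $(X_1,\dots,X_6)=(e_1,-e_1,e_2,-e_2,e_3,-e_3)$, $\lambda_j=-a$. Then $\Delta$ is the convex hull of the points $(\pm a,\pm a,\pm a)$, Delzant's condition holds, and: - $N=\{(s_1,s_1,s_2,s_2,s_3,s_3)\mid s_k\in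 S^1\}\cong (S^1)^3$, as topological groups; - $\Psi^{-1}(0)=\{z\in\mathbb C^6\mid |z_1|^2+|z_2|^2=|z_3|^2+|z_4|^2=|z_5|^2+|z_6|^2=2a\}$, and there is a symplectomorphism $M_\Delta\cong S^2\times S^2\times S^2$, where each $S^2\subset\mathbb R^3$ is the sphere of radius $\sqrt{2a}$ centred at $0$ (radius $\sqrt2$ for $a=1$) with the symplectic form $\frac1{4\pi}$ times its area form (oriented by the outward normal). It takes the action of $\mathbb R^3/\mathbb Z^3$ to the rotation of the $k$-th sphere by the angle $2\pi t_k$ about the vertical axis, and the moment map $\Phi$ to $(p_1,p_2,p_3)\mapsto\sqrt{a/2}\,(h(p_1),h(p_2),h(p_3))$, where $h$ is the third coordinate; - $N_{\mathbb C}=\{(s_1,s_1,s_2,s_2,s_3,s_3)\mid s_k\in\mathbb C^*\}\cong(\mathbb C^*)^3$, as topological groups, $\mathbb C^6_\Delta=(\mathbb C^2\smallsetminus\{0\})^3$, and $[z]\mapsto([z_1:z_2],[z_3:z_4],[z_5:z_6])$ is a biholomorphism $X_\Delta\to\mathbb{CP}^1\times\mathbb{CP}^1\times\mathbb{CP}^1$.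 -/

import Mathlib

open scoped ContDiff Manifold LinearAlgebra.Projectivization

noncomputable section

namespace Toric

/-! ## Complex projective space as a complex manifold -/

/-- Complex projective `n`-space: the lines through the origin of `ℂⁿ⁺¹`. -/
def CP (n : ℕ) : Type := ℙ ℂ (EuclideanSpace ℂ (Fin (n + 1)))

namespace CP

/-- The point `[v 0 : ⋯ : v n]` of projective space. -/
def mk {n : ℕ} (v : EuclideanSpace ℂ (Fin (n + 1))) (hv : v ≠ 0) : CP n :=
  Projectivization.mk ℂ v hv

/-- The canonical projection from the nonzero vectors to projective space. -/
def proj {n : ℕ} (v : {v : EuclideanSpace ℂ (Fin (n + 1)) // v ≠ 0}) : CP n := mk v.1 v.2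

/-- The quotient topology. -/
instance (n : ℕ) : TopologicalSpace (CP n) :=
  TopologicalSpace.coinduced (proj (n := n)) inferInstance

theorem isQuotientMap_proj (n : ℕ) : Topology.IsQuotientMap (proj (n := n)) :=
  ⟨⟨rfl⟩, fun x => by
    induction x using Projectivization.ind with
    | h v hv => exact ⟨⟨v, hv⟩, rfl⟩⟩

theorem mk_eq_mk_iff {n : ℕ} {v w : EuclideanSpace ℂ (Fin (n + 1))} (hv : v ≠ 0) (hw : w ≠ 0) :
    mk v hv = mk w hw ↔ ∃ a : ℂ, a • w = v :=
  Projectivization.mk_eq_mk_iff' ℂ v w hv hw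

theorem insert_ne_zero {n : ℕ} (i : Fin (n + 1)) (w : EuclideanSpace ℂ (Fin n)) :
    (WithLp.toLp 2 (i.insertNth (α := fun _ => ℂ) 1 w.ofLp) : EuclideanSpace ℂ (Fin (n + 1))) ≠ 0 := by
  intro h
  have := congrArg (fun v : EuclideanSpace ℂ (Fin (n + 1)) => v i) h
  simp at this

/-- The domain of the `i`-th affine chart: the points whose `i`-th homogeneous coordinate is
nonzero. -/
def affineSource {n : ℕ} (i : Fin (n + 1)) : Set (CP n) :=
  {x | ∃ (v : EuclideanSpace ℂ (Fin (n + 1))) (hv : v ≠ 0), v i ≠ 0 ∧ mk v hv = x}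

theorem mk_mem_affineSource {n : ℕ} {i : Fin (n + 1)} {v : EuclideanSpace ℂ (Fin (n + 1))}
    {hv : v ≠ 0} : mk v hv ∈ affineSource i ↔ v i ≠ 0 := by
  constructor
  · rintro ⟨w, hw, hi, h⟩ h0
    obtain ⟨a, rfl⟩ := (mk_eq_mk_iff _ _).1 h
    simp [h0] at hi
  · exact fun h => ⟨v, hv, h, rfl⟩

/-- The `i`-th affine coordinates `v k / v i`, `k ≠ i`, of the point `[v 0 : ⋯ : v n]`. -/
def affineCoord {n : ℕ} (i : Fin (n + 1)) (x : CP n) : EuclideanSpace ℂ (Fin n) :=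
  Projectivization.lift
    (fun v : {v : EuclideanSpace ℂ (Fin (n + 1)) // v ≠ 0} =>
      (WithLp.toLp 2 fun k : Fin n => v.1 (i.succAbove k) / v.1 i : EuclideanSpace ℂ (Fin n)))
    (by
      rintro ⟨a, ha⟩ ⟨b, hb⟩ t h
      simp only at h
      subst h
      have ht : t ≠ 0 := by rintro rfl; simp at ha
      ext k
      simp [mul_div_mul_left _ _ ht]) x

theorem affineCoord_mk {n : ℕ} (i : Fin (n + 1)) (v : EuclideanSpace ℂ (Fin (n + 1)))
    (hv : v ≠ 0) :
    affineCoord i (mk v hv) = WithLp.toLp 2 fun k : Fin n => v (i.succAbove k) / v i := rfl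

/-- The point with `i`-th homogeneous coordinate `1` and the other ones given by `w`. -/
def affineInv {n : ℕ} (i : Fin (n + 1)) (w : EuclideanSpace ℂ (Fin n)) : CP n :=
  mk (WithLp.toLp 2 (i.insertNth (α := fun _ => ℂ) 1 w.ofLp)) (insert_ne_zero i w)

theorem isOpen_affineSource {n : ℕ} (i : Fin (n + 1)) : IsOpen (affineSource (n := n) i) := by
  rw [← (isQuotientMap_proj n).isOpen_preimage]
  have : proj (n := n) ⁻¹' affineSource i = {v | v.1 i ≠ 0} := by
    ext v
    exact mk_mem_affineSource
  rw [this]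
  exact isOpen_ne_fun (by fun_prop) continuous_const

/-- The `i`-th affine chart of projective space. -/
def affineChart {n : ℕ} (i : Fin (n + 1)) :
    OpenPartialHomeomorph (CP n) (EuclideanSpace ℂ (Fin n)) where
  toFun := affineCoord i
  invFun := affineInv i
  source := affineSource i
  target := Set.univ
  map_source' _ _ := Set.mem_univ _
  map_target' w _ := by simp [affineInv, mk_mem_affineSource]
  left_inv' := by
    rintro x ⟨v, hv, hi, rfl⟩
    rw [affineInv, mk_eq_mk_iff]
    refine ⟨(v i)⁻¹, ?_⟩
    ext k
    refine Fin.succAboveCases i ?_ (fun k => ?_) k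
    · simp [hi]
    · simp [affineCoord_mk, div_eq_inv_mul]
  right_inv' w _ := by
    ext k
    simp [affineInv, affineCoord_mk]
  open_source := isOpen_affineSource i
  open_target := isOpen_univ
  continuousOn_toFun := by
    rw [(isQuotientMap_proj n).continuousOn_isOpen_iff (isOpen_affineSource i)]
    have : proj (n := n) ⁻¹' affineSource i = {v | v.1 i ≠ 0} := by
      ext v
      exact mk_mem_affineSource
    rw [this]
    refine (PiLp.continuous_toLp 2 _).comp_continuousOn (continuousOn_pi.2 fun k => ?_)
    exact ContinuousOn.div (by fun_prop) (by fun_prop) fun v hv => hv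
  continuousOn_invFun := by
    refine Continuous.continuousOn ?_
    have h : Continuous fun w : EuclideanSpace ℂ (Fin n) =>
        (⟨WithLp.toLp 2 (i.insertNth (α := fun _ => ℂ) 1 w.ofLp), insert_ne_zero i w⟩ :
          {v : EuclideanSpace ℂ (Fin (n + 1)) // v ≠ 0}) := by
      refine Continuous.subtype_mk ((PiLp.continuous_toLp 2 _).comp (continuous_pi fun k => ?_)) _
      refine Fin.succAboveCases i ?_ (fun k => ?_) k
      · simpa using continuous_const
      · simpa using (by fun_prop)
    exact (isQuotientMap_proj n).continuous.comp h

theorem exists_mem_affineSource {n : ℕ} (x : CP n) : ∃ i : Fin (n + 1), x ∈ affineSource i := by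
  induction x using Projectivization.ind with
  | h v hv =>
    by_contra! h
    refine hv ?_
    ext i
    by_contra hi
    exact h i ⟨v, hv, hi, rfl⟩

/-- Projective space with the atlas of its affine charts. -/
instance (n : ℕ) : ChartedSpace (EuclideanSpace ℂ (Fin n)) (CP n) where
  atlas := Set.range affineChart
  chartAt x := affineChart (exists_mem_affineSource x).choose
  mem_chart_source x := (exists_mem_affineSource x).choose_spec
  chart_mem_atlas _ := ⟨_, rfl⟩

/-- Projective space is a complex (analytic) manifold. -/
instance (n : ℕ) : IsManifold 𝓘(ℂ, EuclideanSpace ℂ (Fin n)) ω (CP n) := by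
  refine isManifold_of_contDiffOn _ _ _ ?_
  rintro _ _ ⟨i, rfl⟩ ⟨j, rfl⟩
  have hc : ∀ m : Fin (n + 1), ContDiff ℂ ω fun w : EuclideanSpace ℂ (Fin n) =>
      i.insertNth (α := fun _ => ℂ) 1 w.ofLp m := by
    intro m
    refine Fin.succAboveCases i ?_ (fun k => ?_) m
    · simpa using contDiff_const
    · simp only [Fin.insertNth_apply_succAbove]
      fun_prop
  have hs : ∀ w ∈ ((affineChart i).symm ≫ₕ affineChart j).source,
      i.insertNth (α := fun _ => ℂ) 1 w.ofLp j ≠ 0 := by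
    intro w hw
    rw [OpenPartialHomeomorph.trans_source] at hw
    have h2 : affineInv i w ∈ affineSource j := hw.2
    exact mk_mem_affineSource.1 h2
  have hf : ContDiffOn ℂ ω (fun w : EuclideanSpace ℂ (Fin n) =>
      (WithLp.toLp 2 fun k : Fin n => i.insertNth (α := fun _ => ℂ) 1 w.ofLp (j.succAbove k) /
        i.insertNth (α := fun _ => ℂ) 1 w.ofLp j : EuclideanSpace ℂ (Fin n)))
      ((affineChart i).symm ≫ₕ affineChart j).source := by
    rw [contDiffOn_euclidean]
    intro k
    exact ((hc _).contDiffOn).div (hc _).contDiffOn hs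
  have he := hf.congr (f₁ := affineChart j ∘ (affineChart i).symm) fun w _ => rfl
  simpa using he

end CP

/-! ## Polytopes

The dual space `(ℝⁿ)^*` is written in the coordinates dual to the standard basis of `ℝⁿ`, so that
the pairing `⟨μ, X⟩` is `μ ⬝ᵥ X`. -/

/-- `F` is a facet of the `n`-dimensional convex polytope `Δ`: an exposed face of dimension
`n - 1`. -/
def IsFacet {n : ℕ} (Δ F : Set (Fin n → ℝ)) : Prop :=
  IsExposed ℝ Δ F ∧ F.Nonempty ∧ Module.finrank ℝ (vectorSpan ℝ F) + 1 = n

/-- `Δ` is an `n`-dimensional simple convex polytope in `(ℝⁿ)^*`: the convex hull of finitely many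
points, of full dimension, each vertex of which is contained in exactly `n` facets. -/
def IsSimplePolytope {n : ℕ} (Δ : Set (Fin n → ℝ)) : Prop :=
  (∃ S : Set (Fin n → ℝ), S.Finite ∧ Δ = convexHull ℝ S) ∧
  Module.finrank ℝ (vectorSpan ℝ Δ) = n ∧
  ∀ v ∈ Δ.extremePoints ℝ, {F | IsFacet Δ F ∧ v ∈ F}.ncard = n

/-- A quasilattice in `ℝⁿ`: the `ℤ`-span of a finite set of `ℝ`-spanning vectors. -/
def IsQuasilattice {n : ℕ} (Q : AddSubgroup (Fin n → ℝ)) : Prop :=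
  ∃ S : Set (Fin n → ℝ), S.Finite ∧ Submodule.span ℝ S = ⊤ ∧ AddSubgroup.closure S = Q

/-- The lattice `ℤⁿ` in `ℝⁿ`. -/
def intLattice (n : ℕ) : AddSubgroup (Fin n → ℝ) :=
  ((Int.castAddHom ℝ).compLeft (Fin n)).range

/-- The subgroup `ℤⁿ` of `ℂⁿ`. -/
def intLatticeC (n : ℕ) : AddSubgroup (Fin n → ℂ) :=
  ((Int.castAddHom ℂ).compLeft (Fin n)).range

/-! ## Tori and their actions on `ℂᵈ` -/

/-- The torus `Tᵈ = ℝᵈ / ℤᵈ`. -/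
abbrev Torus (d : ℕ) : Type := (Fin d → ℝ) ⧸ intLattice d

/-- The complex torus `ℂᵈ / ℤᵈ`. -/
abbrev TorusC (d : ℕ) : Type := (Fin d → ℂ) ⧸ intLatticeC d

/-- The map `θ ↦ (e^{2πiθ₁}, …, e^{2πiθ_d})` from `ℝᵈ / ℤᵈ` to `(S¹)ᵈ`. -/
def expT (d : ℕ) : Torus d →+ Additive (Fin d → Circle) :=
  QuotientAddGroup.lift (intLattice d)
    { toFun := fun θ => Additive.ofMul fun j => Circle.exp (2 * Real.pi * θ j)
      map_zero' := by
        rw [← ofMul_one]; congr 1; ext j; simp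
      map_add' := fun θ η => by
        rw [← ofMul_mul]; congr 1; ext j; simp [mul_add, Circle.exp_add] }
    (by
      rintro _ ⟨m, rfl⟩
      refine (congrArg Additive.ofMul (?_ : _ = (1 : Fin d → Circle)))
      funext j
      have := Circle.exp_two_pi_mul_int (m j)
      simpa using this)

/-- The map `ζ ↦ (e^{2πiζ₁}, …, e^{2πiζ_d})` from `ℂᵈ / ℤᵈ` to `(ℂ^*)ᵈ`. -/
def expTC (d : ℕ) : TorusC d →+ Additive (Fin d → ℂˣ) :=
  QuotientAddGroup.lift (intLatticeC d)
    { toFun := fun ζ => Additive.ofMul fun j =>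
        Units.mk0 (Complex.exp (2 * Real.pi * Complex.I * ζ j)) (Complex.exp_ne_zero _)
      map_zero' := by
        rw [← ofMul_one]; congr 1; ext j; simp
      map_add' := fun θ η => by
        rw [← ofMul_mul]; congr 1; ext j; simp [mul_add, Complex.exp_add] }
    (by
      rintro _ ⟨m, rfl⟩
      refine (congrArg Additive.ofMul (?_ : _ = (1 : Fin d → ℂˣ)))
      funext j
      ext
      have := Complex.exp_int_mul_two_pi_mul_I (m j)
      simpa [mul_comm] using this)

/-- The diagonal action of `Tᵈ` on `ℂᵈ`. -/
instance (d : ℕ) : AddAction (Torus d) (EuclideanSpace ℂ (Fin d)) where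
  vadd t z := WithLp.toLp 2 fun j => ((expT d t).toMul j : ℂ) * z j
  zero_vadd z := by
    ext j
    change ((expT d 0).toMul j : ℂ) * z j = z j
    simp
  add_vadd s t z := by
    ext j
    change ((expT d (s + t)).toMul j : ℂ) * z j =
      ((expT d s).toMul j : ℂ) * (((expT d t).toMul j : ℂ) * z j)
    simp [mul_assoc]

/-- The diagonal action of `ℂᵈ / ℤᵈ` on `ℂᵈ`. -/
instance (d : ℕ) : AddAction (TorusC d) (EuclideanSpace ℂ (Fin d)) where
  vadd t z := WithLp.toLp 2 fun j => ((expTC d t).toMul j : ℂ) * z j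
  zero_vadd z := by
    ext j
    change ((expTC d 0).toMul j : ℂ) * z j = z j
    simp
  add_vadd s t z := by
    ext j
    change ((expTC d (s + t)).toMul j : ℂ) * z j =
      ((expTC d s).toMul j : ℂ) * (((expTC d t).toMul j : ℂ) * z j)
    simp [mul_assoc]

/-! ## The symplectic and the complex quotient of a polytope -/

/-- A quasilattice `Q` in `ℝⁿ`, vectors `X₁, …, X_d` in `Q` and real numbers `λ₁, …, λ_d`. -/
structure Datum (n d : ℕ) where
  Q : AddSubgroup (Fin n → ℝ)
  isQuasilattice : IsQuasilattice Q
  X : Fin d → Fin n → ℝ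
  X_mem : ∀ j, X j ∈ Q
  lam : Fin d → ℝ

namespace Datum

variable {n d : ℕ} (D : Datum n d)

/-- The set `⋂ j, {μ | ⟨μ, X j⟩ ≥ λ j}`. -/
def polytope : Set (Fin n → ℝ) := {μ | ∀ j, D.lam j ≤ μ ⬝ᵥ D.X j}

/-- The part of `Δ` in the hyperplane `⟨μ, X j⟩ = λ j`. -/
def facet (j : Fin d) : Set (Fin n → ℝ) := {μ ∈ D.polytope | μ ⬝ᵥ D.X j = D.lam j}

/-- `Δ` is a simple `n`-dimensional convex polytope with exactly `d` facets, the `j`-th of them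
being given by the equation `⟨μ, X j⟩ = λ j`. -/
def IsSimple : Prop :=
  IsSimplePolytope D.polytope ∧ Set.BijOn D.facet Set.univ {F | IsFacet D.polytope F}

/-- The hypothesis of Delzant's theorem: `Δ` is simple and for each vertex of `Δ` the normals `X j`
of the facets containing that vertex are a basis of `ℝⁿ` and a `ℤ`-basis of `Q` (so that `Q` is a
lattice). -/
def IsDelzant : Prop :=
  D.IsSimple ∧ ∀ v ∈ D.polytope.extremePoints ℝ,
    LinearIndependent ℝ (fun j : {j : Fin d // v ⬝ᵥ D.X j = D.lam j} => D.X j) ∧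
    AddSubgroup.closure (D.X '' {j | v ⬝ᵥ D.X j = D.lam j}) = D.Q

/-- The linear map `π : ℝᵈ → ℝⁿ` sending `e_j` to `X j`. -/
def piR : (Fin d → ℝ) →ₗ[ℝ] (Fin n → ℝ) := Fintype.linearCombination ℝ D.X

/-- The complexification `ℂᵈ → ℂⁿ` of `π`. -/
def piC : (Fin d → ℂ) →ₗ[ℂ] (Fin n → ℂ) :=
  Fintype.linearCombination ℂ fun j i => (D.X j i : ℂ)

/-- The quasilattice `Q`, as a subgroup of `ℂⁿ`. -/
def QC : AddSubgroup (Fin n → ℂ) :=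
  D.Q.map (Complex.ofRealHom.toAddMonoidHom.compLeft (Fin n))

theorem intLattice_le : intLattice d ≤ D.Q.comap D.piR.toAddMonoidHom := by
  rintro _ ⟨m, rfl⟩
  change D.piR (fun j => (m j : ℝ)) ∈ D.Q
  rw [piR, Fintype.linearCombination_apply]
  refine AddSubgroup.sum_mem _ fun j _ => ?_
  rw [Int.cast_smul_eq_zsmul]
  exact AddSubgroup.zsmul_mem _ (D.X_mem j) _

theorem intLatticeC_le : intLatticeC d ≤ D.QC.comap D.piC.toAddMonoidHom := by
  rintro _ ⟨m, rfl⟩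
  refine ⟨D.piR (fun j => (m j : ℝ)), D.intLattice_le ⟨m, rfl⟩, ?_⟩
  ext i
  simp [piR, piC, Fintype.linearCombination_apply]

/-- The homomorphism `Π : ℝᵈ / ℤᵈ → ℝⁿ / Q` induced by `π`. -/
def PiR : Torus d →+ (Fin n → ℝ) ⧸ D.Q :=
  QuotientAddGroup.map (intLattice d) D.Q D.piR.toAddMonoidHom D.intLattice_le

/-- The homomorphism `ℂᵈ / ℤᵈ → ℂⁿ / Q` induced by the complexification of `π`. -/
def PiC : TorusC d →+ (Fin n → ℂ) ⧸ D.QC :=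
  QuotientAddGroup.map (intLatticeC d) D.QC D.piC.toAddMonoidHom D.intLatticeC_le

/-- The group `N`. -/
def N : AddSubgroup (Torus d) := D.PiR.ker

/-- The group `N_ℂ`. -/
def NC : AddSubgroup (TorusC d) := D.PiC.ker

/-- The Lie algebra `𝔫 = ker π` of `N`. -/
def lieN : Submodule ℝ (Fin d → ℝ) := LinearMap.ker D.piR

/-- The moment map `J z = ∑ j, (|z j|² + λ j) e_j^*` of the `Tᵈ`-action. -/
def J (z : EuclideanSpace ℂ (Fin d)) : Module.Dual ℝ (Fin d → ℝ) :=
  ∑ j, (‖z j‖ ^ 2 + D.lam j) • LinearMap.proj j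

/-- The moment map `Ψ = i^* ∘ J` of the `N`-action, where `i : 𝔫 → ℝᵈ` is the inclusion. -/
def Psi (z : EuclideanSpace ℂ (Fin d)) : Module.Dual ℝ D.lieN :=
  D.lieN.subtype.dualMap (D.J z)

/-- The level set `Ψ⁻¹(0)`. -/
def levelSet : Set (EuclideanSpace ℂ (Fin d)) := D.Psi ⁻¹' {0}

/-- The equivalence relation "same `N`-orbit" on `Ψ⁻¹(0)`. -/
def symplecticSetoid : Setoid D.levelSet :=
  (AddAction.orbitRel D.N (EuclideanSpace ℂ (Fin d))).comap (↑)

/-- The symplectic quotient `M_Δ = Ψ⁻¹(0) / N`, with the quotient topology. -/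
abbrev M : Type := Quotient D.symplecticSetoid

/-- The quotient map `Ψ⁻¹(0) → M_Δ`. -/
def projM (z : D.levelSet) : D.M := Quotient.mk D.symplecticSetoid z

/-- The index sets `I_F` of the open faces `F` of `Δ`: those `I` for which
`F = {μ ∈ Δ | ⟨μ, X j⟩ = λ j ↔ j ∈ I}` is nonempty. -/
def faceSets : Set (Set (Fin d)) :=
  {I | {μ ∈ D.polytope | ∀ j, μ ⬝ᵥ D.X j = D.lam j ↔ j ∈ I}.Nonempty}

/-- The set `ℂᵈ_Δ`, the union over the open faces `F` of the sets
`{z | z j ≠ 0 if j ∉ I_F}`. -/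
def openSet : Set (EuclideanSpace ℂ (Fin d)) := ⋃ I ∈ D.faceSets, {z | ∀ j ∉ I, z j ≠ 0}

/-- The equivalence relation "same `N_ℂ`-orbit" on `ℂᵈ_Δ`. -/
def complexSetoid : Setoid D.openSet :=
  (AddAction.orbitRel D.NC (EuclideanSpace ℂ (Fin d))).comap (↑)

/-- The complex quotient `X_Δ = ℂᵈ_Δ / N_ℂ`, with the quotient topology. -/
abbrev XΔ : Type := Quotient D.complexSetoid

/-- The quotient map `ℂᵈ_Δ → X_Δ`. -/
def projX (z : D.openSet) : D.XΔ := Quotient.mk D.complexSetoid z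

end Datum

/-! ## Isomorphisms of quotients

The symplectic quotients are presented as quotients of subsets of vector spaces, the
symplectic form being induced by the restriction of a `2`-form `(z, u, v) ↦ ω_z(u, v)` to the
tangent vectors. -/

/-- The standard symplectic form `ω₀ = (1 / 2πi) ∑ j, dz_j ∧ d\bar z_j` of `ℂᵈ`. -/
def omega0 {d : ℕ} (_z u v : EuclideanSpace ℂ (Fin d)) : ℝ :=
  (1 / (2 * Real.pi * Complex.I) *
    ∑ j, (u j * starRingEnd ℂ (v j) - v j * starRingEnd ℂ (u j))).re

/-- The tangent vectors at `z` of a subset `P` of a vector space: the velocities of the smooth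
(germs of) curves in `P` through `z`. -/
def tangentVectors {E : Type*} [NormedAddCommGroup E] [NormedSpace ℝ E] (P : Set E) (z : E) :
    Set E :=
  {u | ∃ γ : ℝ → E, ContDiffAt ℝ ∞ γ 0 ∧ (∀ᶠ t in nhds 0, γ t ∈ P) ∧ γ 0 = z ∧ HasDerivAt γ u 0}

section Symplectic

variable {E E' M M' : Type*} [NormedAddCommGroup E] [NormedSpace ℝ E]
  [NormedAddCommGroup E'] [NormedSpace ℝ E']

/-- Let `M` and `M'` be quotients, with quotient maps `p` and `p'`, of submanifolds `P ⊆ E` and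
`P' ⊆ E'`. The map `F : M → M'` is smooth and preserves the forms induced by `w` and `w'` if locally
it lifts to a smooth map `h` from `P` to `P'` that preserves these forms on tangent vectors. -/
def IsSymplecticMap {P : Set E} {P' : Set E'} (p : P → M) (p' : P' → M')
    (w : E → E → E → ℝ) (w' : E' → E' → E' → ℝ) (F : M → M') : Prop :=
  ∀ z : P, ∃ (U : Set E) (h : E → E'), IsOpen U ∧ (z : E) ∈ U ∧ ContDiffOn ℝ ∞ h U ∧
    (∀ x : P, (x : E) ∈ U → ∃ hx : h x ∈ P', F (p x) = p' ⟨h x, hx⟩) ∧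
    ∀ x ∈ P ∩ U, ∀ u ∈ tangentVectors P x, ∀ v ∈ tangentVectors P x,
      w x u v = w' (h x) (fderiv ℝ h x u) (fderiv ℝ h x v)

/-- A symplectomorphism between quotients: a homeomorphism that is smooth and symplectic in both
directions. -/
def IsSymplectomorphism [TopologicalSpace M] [TopologicalSpace M'] {P : Set E} {P' : Set E'}
    (p : P → M) (p' : P' → M') (w : E → E → E → ℝ) (w' : E' → E' → E' → ℝ) (F : M ≃ₜ M') : Prop :=
  IsSymplecticMap p p' w w' F ∧ IsSymplecticMap p' p w' w F.symm

end Symplectic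

/-- Let `M` be the quotient of the open set `U ⊆ E`, with quotient map `p`. The homeomorphism `F`
from `M` to the complex manifold `Y` is biholomorphic if `F ∘ p` is holomorphic and the inverse of
`F` locally lifts to a holomorphic map to `U`. -/
def IsBiholomorphism {E E' H M Y : Type*} [NormedAddCommGroup E] [NormedSpace ℂ E]
    [NormedAddCommGroup E'] [NormedSpace ℂ E'] [TopologicalSpace H] [TopologicalSpace M]
    [TopologicalSpace Y] [ChartedSpace H Y] {U : Set E} (p : U → M) (I : ModelWithCorners ℂ E' H)
    (F : M ≃ₜ Y) : Prop :=
  IsOpen U ∧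
  (∃ h : E → Y, ContMDiffOn 𝓘(ℂ, E) I ω h U ∧ ∀ z : U, h z = F (p z)) ∧
  ∀ y : Y, ∃ (V : Set Y) (s : Y → E), IsOpen V ∧ y ∈ V ∧ ContMDiffOn I 𝓘(ℂ, E) ω s V ∧
    ∀ x ∈ V, ∃ hx : s x ∈ U, p ⟨s x, hx⟩ = F.symm x

/-! ## Odd spheres modulo the circle, and products of `2`-spheres -/

/-- The equivalence relation "same orbit of the diagonal action of `S¹`" on the sphere of radius `r`
in `ℂᵈ`. -/
def circleSetoid (d : ℕ) (r : ℝ) : Setoid (Metric.sphere (0 : EuclideanSpace ℂ (Fin d)) r) :=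
  (MulAction.orbitRel Circle (EuclideanSpace ℂ (Fin d))).comap (↑)

/-- The quotient of the sphere of radius `r` in `ℂᵈ` by the diagonal action of `S¹`. -/
abbrev SphereModCircle (d : ℕ) (r : ℝ) : Type := Quotient (circleSetoid d r)

/-- The quotient map. -/
def projSphere (d : ℕ) (r : ℝ) (z : Metric.sphere (0 : EuclideanSpace ℂ (Fin d)) r) :
    SphereModCircle d r := Quotient.mk (circleSetoid d r) z

/-- The product `S² × S² × S²` of three `2`-spheres of radius `r` in `ℝ³`. -/
def threeSpheres (r : ℝ) : Set (Fin 3 → EuclideanSpace ℝ (Fin 3)) :=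
  Set.univ.pi fun _ => Metric.sphere 0 r

/-- The area form, at the point `p`, of the sphere of radius `‖p‖` in `ℝ³` oriented by the outward
normal: `(u, v) ↦ det (p / ‖p‖, u, v)`. -/
def areaForm (p u v : EuclideanSpace ℝ (Fin 3)) : ℝ :=
  Matrix.det (Matrix.of ![p.ofLp, u.ofLp, v.ofLp]) / ‖p‖

/-- The sum over the three factors of `1 / 4π` times the area form. -/
def threeSpheresForm (p u v : Fin 3 → EuclideanSpace ℝ (Fin 3)) : ℝ :=
  ∑ k, 1 / (4 * Real.pi) * areaForm (p k) (u k) (v k)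

/-- The rotation of `ℝ³` by the angle `α` about the third axis. -/
def rotation (α : ℝ) (p : EuclideanSpace ℝ (Fin 3)) : EuclideanSpace ℝ (Fin 3) :=
  !₂[Real.cos α * p 0 - Real.sin α * p 1, Real.sin α * p 0 + Real.cos α * p 1, p 2]

/-! ## The regular tetrahedron and the cube -/

/-- The vectors `Y₁, …, Y₄`. -/
def Y : Fin 4 → Fin 3 → ℝ := ![![1, 1, 1], ![1, -1, -1], ![-1, 1, -1], ![-1, -1, 1]]

/-- The lattice `L` generated by `Y₁, …, Y₄`. -/
def L : AddSubgroup (Fin 3 → ℝ) := AddSubgroup.closure (Set.range Y)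

theorem span_Y : Submodule.span ℝ (Set.range Y) = ⊤ := by
  have hY : ∀ j, Y j ∈ Submodule.span ℝ (Set.range Y) := fun j => Submodule.subset_span ⟨j, rfl⟩
  refine eq_top_iff.2 fun v _ => ?_
  have : v = ((v 0 + v 1) / 2) • Y 0 + ((v 0 - v 2) / 2) • Y 1 + ((v 1 - v 2) / 2) • Y 2 := by
    ext i
    fin_cases i <;> simp [Y] <;> ring
  rw [this]
  exact add_mem (add_mem (Submodule.smul_mem _ _ (hY 0)) (Submodule.smul_mem _ _ (hY 1)))
    (Submodule.smul_mem _ _ (hY 2))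

/-- The tetrahedron: `X_j = Y_j` and `λ_j = -1`, with respect to the lattice `L`. -/
def tetrahedron : Datum 3 4 where
  Q := L
  isQuasilattice := ⟨Set.range Y, Set.finite_range Y, span_Y, rfl⟩
  X := Y
  X_mem j := AddSubgroup.subset_closure ⟨j, rfl⟩
  lam _ := -1

/-- The vectors `e₁, -e₁, e₂, -e₂, e₃, -e₃`. -/
def cubeNormal : Fin 6 → Fin 3 → ℝ :=
  ![Pi.single 0 1, -Pi.single 0 1, Pi.single 1 1, -Pi.single 1 1, Pi.single 2 1, -Pi.single 2 1]

theorem isQuasilattice_intLattice : IsQuasilattice (intLattice 3) := by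
  refine ⟨Set.range fun i : Fin 3 => (Pi.single i 1 : Fin 3 → ℝ), Set.finite_range _, ?_, ?_⟩
  · refine eq_top_iff.2 fun v _ => ?_
    have hv : v = ∑ i, v i • (Pi.single i 1 : Fin 3 → ℝ) := by
      ext k
      simp [Finset.sum_apply, Pi.single_apply]
    rw [hv]
    exact Submodule.sum_mem _ fun i _ =>
      Submodule.smul_mem _ _ (Submodule.subset_span (Set.mem_range_self i))
  · refine le_antisymm ((AddSubgroup.closure_le _).2 ?_) ?_
    · rintro w hw
      obtain ⟨i, rfl⟩ := hw
      refine ⟨Pi.single i 1, ?_⟩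
      ext k
      by_cases h : k = i <;> simp [h]
    · rintro _ ⟨m, rfl⟩
      have : ((Int.castAddHom ℝ).compLeft (Fin 3)) m =
          ∑ i, m i • (Pi.single i 1 : Fin 3 → ℝ) := by
        ext k
        simp [Finset.sum_apply, Pi.single_apply]
      rw [this]
      exact AddSubgroup.sum_mem _ fun i _ => AddSubgroup.zsmul_mem _
        (AddSubgroup.subset_closure (Set.mem_range_self i)) _

theorem cubeNormal_mem (j : Fin 6) : cubeNormal j ∈ intLattice 3 := by
  have h : ∀ i : Fin 3, (Pi.single i 1 : Fin 3 → ℝ) ∈ intLattice 3 := by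
    intro i
    refine ⟨Pi.single i 1, ?_⟩
    ext k
    by_cases h : k = i <;> simp [h]
  fin_cases j
  · exact h 0
  · exact neg_mem (h 0)
  · exact h 1
  · exact neg_mem (h 1)
  · exact h 2
  · exact neg_mem (h 2)

/-- The cube of side `2a`: normals `±e_i` and `λ_j = -a`, with respect to the lattice `ℤ³`. -/
def cube (a : ℝ) : Datum 3 6 where
  Q := intLattice 3
  isQuasilattice := isQuasilattice_intLattice
  X := cubeNormal
  X_mem := cubeNormal_mem
  lam _ := -a

end Toric

end

/-! Both examples are governed by the linear relations among the normals. The four vectors `Y j` sum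
to zero, and up to scale this is their only relation. The cube normals satisfy only the relations
generated by `e_i + (-e_i) = 0`. So the kernel of `π`, real or complex, consists of the vectors that
are constant on the fibres of a map `f` of index sets: onto a point for the tetrahedron, onto the
three axes (`cubeAxis`) for the cube. As the normals generate `Q`, the image of `ℤᵈ` under `π` is
all of `Q`, so every class in `N` has a representative in the kernel of `π`. Exponentiating, `N` and
`N_ℂ` are the tuples constant on the fibres of `f` (`mem_N_iff_exists_comp`,
`mem_NC_iff_exists_comp`). Testing `J z` against the same kernel gives the equations of the level
set, and `mem_openSet` turns `ℂᵈ_Δ` into the question which facets have a common point.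

Both quotients are then identified by one principle, `exists_homeomorph_of_local_sections`: a
continuous map with continuous local sections, whose fibres are the orbits, induces a homeomorphism
from the orbit space to its target. On the complex side the map is given by homogeneous coordinates
and the sections by the affine charts; all of these are holomorphic. On the symplectic side the
tetrahedron needs only the identity of `S⁷`. For the cube the map is a product of three Hopf maps
`ℂ² → ℝ³`. A polynomial determinant identity (`det_hopfDeriv`) shows that on a sphere the Hopf map
pulls back the area form to `4 Im⟨u, v⟩`, whereas `ω₀` is `(1 / π) Im⟨u, v⟩`; this gives the factor
`1 / 4π`. Smooth sections over the complements of the poles handle the inverse.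

Delzant's condition is reduced by `isDelzant_of` to finite data: a point in the relative interior of
each facet, and the normals at each vertex. The key is `exists_eq_facet`: every facet of `Δ` comes
from one of the given inequalities. -/

noncomputable section

namespace Toric

/-! ## The exponential maps of the tori -/

theorem expT_mk {d : ℕ} (θ : Fin d → ℝ) (j : Fin d) :
    (expT d (QuotientAddGroup.mk θ)).toMul j = Circle.exp (2 * Real.pi * θ j) := rfl

theorem expTC_mk {d : ℕ} (ζ : Fin d → ℂ) (j : Fin d) :
    ((expTC d (QuotientAddGroup.mk ζ)).toMul j : ℂ) =
      Complex.exp (2 * Real.pi * Complex.I * ζ j) := rfl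

theorem expT_injective (d : ℕ) : Function.Injective (expT d) := by
  rw [injective_iff_map_eq_zero]
  intro t ht
  obtain ⟨θ, rfl⟩ := QuotientAddGroup.mk_surjective t
  have h : ∀ j, ∃ m : ℤ, (m : ℝ) = θ j := by
    intro j
    have hj : Circle.exp (2 * Real.pi * θ j) = Circle.exp 0 := by
      rw [← expT_mk, ht, Circle.exp_zero]; rfl
    obtain ⟨m, hm⟩ := Circle.exp_eq_exp.1 hj
    refine ⟨m, ?_⟩
    have h2 : 2 * Real.pi * m = 2 * Real.pi * θ j := by rw [hm]; ring
    exact mul_left_cancel₀ (by positivity) h2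
  choose m hm using h
  exact (QuotientAddGroup.eq_zero_iff _).2 ⟨m, funext hm⟩

theorem expTC_injective (d : ℕ) : Function.Injective (expTC d) := by
  rw [injective_iff_map_eq_zero]
  intro t ht
  obtain ⟨ζ, rfl⟩ := QuotientAddGroup.mk_surjective t
  have h : ∀ j, ∃ m : ℤ, (m : ℂ) = ζ j := by
    intro j
    have hj : Complex.exp (2 * Real.pi * Complex.I * ζ j) = 1 := by
      rw [← expTC_mk, ht]; rfl
    obtain ⟨m, hm⟩ := Complex.exp_eq_one_iff.1 hj
    refine ⟨m, ?_⟩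
    have h0 := Complex.two_pi_I_ne_zero
    exact mul_left_cancel₀ h0 (by rw [hm, mul_comm])
  choose m hm using h
  exact (QuotientAddGroup.eq_zero_iff _).2 ⟨m, funext hm⟩

theorem expT_mk_arg {d : ℕ} (s : Fin d → Circle) :
    expT d (QuotientAddGroup.mk fun j => Complex.arg (s j) / (2 * Real.pi)) =
      Additive.ofMul s := by
  refine congrArg Additive.ofMul (funext fun j => ?_)
  have : 2 * Real.pi * (Complex.arg (s j) / (2 * Real.pi)) = Complex.arg (s j) := by
    field_simp
  exact (congrArg Circle.exp this).trans (Circle.exp_arg _)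

theorem expTC_mk_log {d : ℕ} (s : Fin d → ℂˣ) :
    expTC d (QuotientAddGroup.mk fun j => Complex.log (s j) / (2 * Real.pi * Complex.I)) =
      Additive.ofMul s := by
  refine congrArg Additive.ofMul (funext fun j => Units.ext ?_)
  have : 2 * Real.pi * Complex.I * (Complex.log (s j) / (2 * Real.pi * Complex.I)) =
      Complex.log (s j) := mul_div_cancel₀ _ Complex.two_pi_I_ne_zero
  exact (congrArg Complex.exp this).trans (Complex.exp_log (s j).ne_zero)

theorem continuous_expT (d : ℕ) : Continuous (expT d) := by
  refine Continuous.quotient_lift ?_ _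
  refine continuous_ofMul.comp (continuous_pi fun j => ?_)
  fun_prop

theorem continuous_expTC (d : ℕ) : Continuous (expTC d) := by
  refine Continuous.quotient_lift ?_ _
  refine continuous_ofMul.comp (continuous_pi fun j => ?_)
  rw [Units.continuous_iff]
  refine ⟨?_, ?_⟩
  · change Continuous fun ζ : Fin d → ℂ => Complex.exp (2 * Real.pi * Complex.I * ζ j)
    fun_prop
  · change Continuous fun ζ : Fin d → ℂ => (Complex.exp (2 * Real.pi * Complex.I * ζ j))⁻¹
    exact Continuous.inv₀ (by fun_prop) fun _ => Complex.exp_ne_zero _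

/-- `ℝᵈ / ℤᵈ` is isomorphic to `(S¹)ᵈ`. -/
def expTEquiv (d : ℕ) : Torus d ≃ₜ+ Additive (Fin d → Circle) where
  __ := AddEquiv.ofBijective (expT d)
    ⟨expT_injective d, fun s => ⟨_, expT_mk_arg s.toMul⟩⟩
  continuous_toFun := continuous_expT d
  continuous_invFun := by
    set E := AddEquiv.ofBijective (expT d)
      ⟨expT_injective d, fun s => ⟨_, expT_mk_arg s.toMul⟩⟩ with hE
    have h : ∀ s, E.symm s = QuotientAddGroup.mk fun j =>
        Complex.arg (s.toMul j) / (2 * Real.pi) := fun s => by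
      rw [AddEquiv.symm_apply_eq]
      exact (expT_mk_arg s.toMul).symm
    -- The inverse is a homomorphism, so continuity at the identity suffices; there every coordinate
    -- is `1`, away from the branch cut of `arg`.
    refine continuous_of_continuousAt_zero E.symm.toAddMonoidHom ?_
    have : (E.symm.toAddMonoidHom : Additive (Fin d → Circle) → Torus d) = fun s =>
      QuotientAddGroup.mk fun j => Complex.arg (s.toMul j) / (2 * Real.pi) := funext h
    rw [this]
    refine (QuotientAddGroup.continuous_mk.continuousAt).comp (continuousAt_pi.2 fun j => ?_)
    refine ContinuousAt.div_const ?_ _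
    have hc : Continuous fun s : Additive (Fin d → Circle) => (s.toMul j : ℂ) :=
      continuous_subtype_val.comp ((continuous_apply j).comp continuous_toMul)
    refine ContinuousAt.comp (g := Complex.arg) ?_ hc.continuousAt
    exact Complex.continuousAt_arg (by simp)

/-- `ℂᵈ / ℤᵈ` is isomorphic to `(ℂ^*)ᵈ`. -/
def expTCEquiv (d : ℕ) : TorusC d ≃ₜ+ Additive (Fin d → ℂˣ) where
  __ := AddEquiv.ofBijective (expTC d)
    ⟨expTC_injective d, fun s => ⟨_, expTC_mk_log s.toMul⟩⟩
  continuous_toFun := continuous_expTC d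
  continuous_invFun := by
    set E := AddEquiv.ofBijective (expTC d)
      ⟨expTC_injective d, fun s => ⟨_, expTC_mk_log s.toMul⟩⟩ with hE
    have h : ∀ s, E.symm s = QuotientAddGroup.mk fun j =>
        Complex.log (s.toMul j) / (2 * Real.pi * Complex.I) := fun s => by
      rw [AddEquiv.symm_apply_eq]
      exact (expTC_mk_log s.toMul).symm
    -- Again only the identity matters, and the principal logarithm is continuous at `1`.
    refine continuous_of_continuousAt_zero E.symm.toAddMonoidHom ?_
    have : (E.symm.toAddMonoidHom : Additive (Fin d → ℂˣ) → TorusC d) = fun s =>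
      QuotientAddGroup.mk fun j => Complex.log (s.toMul j) / (2 * Real.pi * Complex.I) := funext h
    rw [this]
    refine (QuotientAddGroup.continuous_mk.continuousAt).comp (continuousAt_pi.2 fun j => ?_)
    refine ContinuousAt.div_const ?_ _
    have hc : Continuous fun s : Additive (Fin d → ℂˣ) => (s.toMul j : ℂ) :=
      Units.continuous_val.comp ((continuous_apply j).comp continuous_toMul)
    refine ContinuousAt.comp (g := Complex.log) ?_ hc.continuousAt
    exact continuousAt_clog (by simp)

/-- A subgroup that corresponds under `E` to the image of an embedding `φ` with continuous left
inverse `ψ`. -/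
theorem exists_continuousAddEquiv {A B G : Type*} [AddCommGroup A] [TopologicalSpace A]
    [AddCommGroup B] [TopologicalSpace B] [AddCommGroup G] [TopologicalSpace G]
    (E : A ≃ₜ+ B) (N : AddSubgroup A) (φ : G →+ B) (hφ : Continuous φ) (ψ : B → G)
    (hψ : Continuous ψ) (hl : ∀ g, ψ (φ g) = g) (hN : ∀ t, t ∈ N ↔ ∃ g, E t = φ g) :
    ∃ e : G ≃ₜ+ N, ∀ g, E (e g) = φ g := by
  refine ⟨{ toFun := fun g => ⟨E.symm (φ g), (hN _).2 ⟨g, by simp⟩⟩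
            invFun := fun t => ψ (E t)
            left_inv := fun g => by simp [hl]
            right_inv := fun t => ?_
            map_add' := fun g g' => by ext; simp
            continuous_toFun := ?_
            continuous_invFun := ?_ }, fun g => ?_⟩
  · obtain ⟨g, hg⟩ := (hN t).1 t.2
    ext
    change E.symm (φ (ψ (E t))) = t
    rw [hg, hl, ← hg, E.symm_apply_apply]
  · exact (E.symm.continuous.comp hφ).subtype_mk _
  · exact hψ.comp (E.continuous.comp continuous_subtype_val)
  · exact E.apply_symm_apply _

/-! ## The groups `N` and `N_ℂ` -/

namespace Datum

variable {n d : ℕ} (D : Datum n d)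

theorem piR_apply (θ : Fin d → ℝ) : D.piR θ = ∑ j, θ j • D.X j :=
  Fintype.linearCombination_apply ..

theorem piC_apply (ζ : Fin d → ℂ) (i : Fin n) : D.piC ζ i = ∑ j, ζ j * D.X j i := by
  simp [piC, Fintype.linearCombination_apply]

theorem mk_mem_N {θ : Fin d → ℝ} : (QuotientAddGroup.mk θ : Torus d) ∈ D.N ↔ D.piR θ ∈ D.Q := by
  rw [N, AddMonoidHom.mem_ker]
  exact QuotientAddGroup.eq_zero_iff _

theorem mk_mem_NC {ζ : Fin d → ℂ} :
    (QuotientAddGroup.mk ζ : TorusC d) ∈ D.NC ↔ D.piC ζ ∈ D.QC := by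
  rw [NC, AddMonoidHom.mem_ker]
  exact QuotientAddGroup.eq_zero_iff _

/-- The image of `ℤᵈ` under `π` is a subgroup containing every `X j`. This allows a representative
of an element of `N` to be moved into the kernel of `π` by an integer vector. -/
theorem exists_int_of_mem_Q (hQ : AddSubgroup.closure (Set.range D.X) = D.Q) {v : Fin n → ℝ}
    (hv : v ∈ D.Q) : ∃ m : Fin d → ℤ, D.piR (fun j => m j) = v := by
  have h : AddSubgroup.closure (Set.range D.X) ≤ (intLattice d).map D.piR.toAddMonoidHom := by
    rw [AddSubgroup.closure_le]
    rintro _ ⟨j, rfl⟩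
    refine ⟨_, ⟨Pi.single j 1, rfl⟩, ?_⟩
    change D.piR (fun k => ((Pi.single j 1 : Fin d → ℤ) k : ℝ)) = D.X j
    simp [piR_apply, Pi.single_apply]
  obtain ⟨_, ⟨m, rfl⟩, hm⟩ := h (hQ.symm ▸ hv)
  exact ⟨m, hm⟩

/-- If the `X j` generate `Q`, then `N` is the image of the kernel of `π`. -/
theorem mem_N_iff (hQ : AddSubgroup.closure (Set.range D.X) = D.Q) {t : Torus d} :
    t ∈ D.N ↔ ∃ η : Fin d → ℝ, D.piR η = 0 ∧ QuotientAddGroup.mk η = t := by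
  constructor
  · obtain ⟨θ, rfl⟩ := QuotientAddGroup.mk_surjective t
    intro h
    obtain ⟨m, hm⟩ := D.exists_int_of_mem_Q hQ (D.mk_mem_N.1 h)
    -- Subtracting the integer vector `m`, which has the same image as `θ`, does not change the
    -- class in the torus.
    refine ⟨θ - fun j => (m j : ℝ), by rw [map_sub, hm, sub_self], ?_⟩
    rw [QuotientAddGroup.eq]
    exact ⟨m, by ext; simp⟩
  · rintro ⟨η, h, rfl⟩
    exact D.mk_mem_N.2 (h ▸ zero_mem _)

/-- If the `X j` generate `Q`, then `N_ℂ` is the image of the kernel of the complexification of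
`π`. -/
theorem mem_NC_iff (hQ : AddSubgroup.closure (Set.range D.X) = D.Q) {t : TorusC d} :
    t ∈ D.NC ↔ ∃ η : Fin d → ℂ, D.piC η = 0 ∧ QuotientAddGroup.mk η = t := by
  constructor
  · obtain ⟨θ, rfl⟩ := QuotientAddGroup.mk_surjective t
    intro h
    obtain ⟨v, hv, hvt⟩ := D.mk_mem_NC.1 h
    obtain ⟨m, hm⟩ := D.exists_int_of_mem_Q hQ hv
    refine ⟨θ - fun j => (m j : ℂ), ?_, ?_⟩
    · rw [map_sub, ← hvt, ← hm, sub_eq_zero]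
      ext i
      simp [piC_apply, piR_apply]
    · rw [QuotientAddGroup.eq]
      exact ⟨m, by ext; simp⟩
  · rintro ⟨η, h, rfl⟩
    exact D.mk_mem_NC.2 (h ▸ zero_mem _)

/-- If the kernel of `π` consists of the vectors that are constant on the fibres of `f`, then `N`
consists of the elements of `(S¹)ᵈ` with this property. -/
theorem mem_N_iff_exists_comp (hQ : AddSubgroup.closure (Set.range D.X) = D.Q) {ι : Type*}
    (f : Fin d → ι)
    (hker : ∀ η : Fin d → ℝ, D.piR η = 0 ↔ ∃ c : ι → ℝ, η = c ∘ f) (t : Torus d) :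
    t ∈ D.N ↔ ∃ s : ι → Circle, expT d t = Additive.ofMul (s ∘ f) := by
  rw [D.mem_N_iff hQ]
  constructor
  · rintro ⟨η, h, rfl⟩
    obtain ⟨c, rfl⟩ := (hker η).1 h
    exact ⟨fun i => Circle.exp (2 * Real.pi * c i), rfl⟩
  · rintro ⟨s, hs⟩
    -- Principal arguments depend only on `f j`, so this representative is constant on the fibres
    -- and lies in the kernel.
    refine ⟨fun j => Complex.arg (s (f j)) / (2 * Real.pi), (hker _).2
      ⟨fun i => Complex.arg (s i) / (2 * Real.pi), rfl⟩, ?_⟩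
    exact expT_injective d ((expT_mk_arg (s ∘ f)).trans hs.symm)

/-- If the kernel of the complexification of `π` consists of the vectors that are constant on the
fibres of `f`, then `N_ℂ` consists of the elements of `(ℂ^*)ᵈ` with this property. -/
theorem mem_NC_iff_exists_comp (hQ : AddSubgroup.closure (Set.range D.X) = D.Q) {ι : Type*}
    (f : Fin d → ι)
    (hker : ∀ η : Fin d → ℂ, D.piC η = 0 ↔ ∃ c : ι → ℂ, η = c ∘ f) (t : TorusC d) :
    t ∈ D.NC ↔ ∃ s : ι → ℂˣ, expTC d t = Additive.ofMul (s ∘ f) := by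
  rw [D.mem_NC_iff hQ]
  constructor
  · rintro ⟨η, h, rfl⟩
    obtain ⟨c, rfl⟩ := (hker η).1 h
    exact ⟨fun i => Units.mk0 (Complex.exp (2 * Real.pi * Complex.I * c i)) (Complex.exp_ne_zero _),
      rfl⟩
  · rintro ⟨s, hs⟩
    refine ⟨fun j => Complex.log (s (f j)) / (2 * Real.pi * Complex.I), (hker _).2
      ⟨fun i => Complex.log (s i) / (2 * Real.pi * Complex.I), rfl⟩, ?_⟩
    exact expTC_injective d ((expTC_mk_log (s ∘ f)).trans hs.symm)

/-! ## The level set and the open set -/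

theorem mem_levelSet {z : EuclideanSpace ℂ (Fin d)} :
    z ∈ D.levelSet ↔ ∀ η, D.piR η = 0 → ∑ j, (‖z j‖ ^ 2 + D.lam j) * η j = 0 := by
  have h : ∀ η, D.J z η = ∑ j, (‖z j‖ ^ 2 + D.lam j) * η j := fun η => by simp [J]
  constructor
  · intro hz η hη
    rw [← h]
    exact LinearMap.congr_fun (show D.Psi z = 0 from hz) ⟨η, hη⟩
  · intro hz
    change D.Psi z = 0
    ext η
    exact (h η.1).trans (hz _ η.2)

/-- Each `μ` in `Δ` lies in exactly one open face, indexed by the set of all equalities at `μ`. The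
union over the faces therefore becomes an existential over points of `Δ`. -/
theorem mem_openSet {z : EuclideanSpace ℂ (Fin d)} :
    z ∈ D.openSet ↔ ∃ μ ∈ D.polytope, ∀ j, z j = 0 → μ ⬝ᵥ D.X j = D.lam j := by
  simp only [openSet, Set.mem_iUnion, faceSets, exists_prop, Set.mem_ofPred_eq]
  constructor
  · rintro ⟨I, ⟨μ, hμ, hI⟩, hz⟩
    exact ⟨μ, hμ, fun j hj => (hI j).2 (by_contra fun h => hz j h hj)⟩
  · rintro ⟨μ, hμ, h⟩
    exact ⟨{j | μ ⬝ᵥ D.X j = D.lam j}, ⟨μ, hμ, fun _ => Iff.rfl⟩, fun j hj hz => hj (h j hz)⟩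

/-! ### Orbit relations as coordinatewise scalings -/

theorem symplecticSetoid_iff {z w : D.levelSet} :
    D.symplecticSetoid z w ↔ ∃ t ∈ D.N, ∀ j,
      (z : EuclideanSpace ℂ (Fin d)) j = ((expT d t).toMul j : ℂ) * w.1 j := by
  constructor
  · rintro ⟨t, ht⟩
    exact ⟨t, t.2, fun j => (congrArg (fun v : EuclideanSpace ℂ (Fin d) => v j) ht).symm⟩
  · rintro ⟨t, ht, h⟩
    exact ⟨⟨t, ht⟩, by ext j; exact (h j).symm⟩

theorem complexSetoid_iff {z w : D.openSet} :
    D.complexSetoid z w ↔ ∃ t ∈ D.NC, ∀ j,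
      (z : EuclideanSpace ℂ (Fin d)) j = ((expTC d t).toMul j : ℂ) * w.1 j := by
  constructor
  · rintro ⟨t, ht⟩
    exact ⟨t, t.2, fun j => (congrArg (fun v : EuclideanSpace ℂ (Fin d) => v j) ht).symm⟩
  · rintro ⟨t, ht, h⟩
    exact ⟨⟨t, ht⟩, by ext j; exact (h j).symm⟩

theorem symplecticSetoid_iff_exists_comp {ι : Type*} {f : Fin d → ι}
    (hN : ∀ t, t ∈ D.N ↔ ∃ s : ι → Circle, expT d t = Additive.ofMul (s ∘ f)) {z w : D.levelSet} :
    D.symplecticSetoid z w ↔ ∃ s : ι → Circle, ∀ j, z.1 j = s (f j) * w.1 j := by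
  rw [symplecticSetoid_iff]
  constructor
  · rintro ⟨t, ht, h⟩
    obtain ⟨s, hs⟩ := (hN t).1 ht
    exact ⟨s, fun j => by rw [h j, hs]; rfl⟩
  · rintro ⟨s, h⟩
    have he := (expTEquiv d).apply_symm_apply (Additive.ofMul (s ∘ f))
    refine ⟨(expTEquiv d).symm (Additive.ofMul (s ∘ f)), (hN _).2 ⟨s, he⟩, fun j => ?_⟩
    rw [h j]
    exact congrArg (fun u : Additive (Fin d → Circle) => (u.toMul j : ℂ) * w.1 j) he.symm

theorem complexSetoid_iff_exists_comp {ι : Type*} {f : Fin d → ι}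
    (hN : ∀ t, t ∈ D.NC ↔ ∃ s : ι → ℂˣ, expTC d t = Additive.ofMul (s ∘ f)) {z w : D.openSet} :
    D.complexSetoid z w ↔ ∃ s : ι → ℂˣ, ∀ j, z.1 j = s (f j) * w.1 j := by
  rw [complexSetoid_iff]
  constructor
  · rintro ⟨t, ht, h⟩
    obtain ⟨s, hs⟩ := (hN t).1 ht
    exact ⟨s, fun j => by rw [h j, hs]; rfl⟩
  · rintro ⟨s, h⟩
    have he := (expTCEquiv d).apply_symm_apply (Additive.ofMul (s ∘ f))
    refine ⟨(expTCEquiv d).symm (Additive.ofMul (s ∘ f)), (hN _).2 ⟨s, he⟩, fun j => ?_⟩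
    rw [h j]
    exact congrArg (fun u : Additive (Fin d → ℂˣ) => (u.toMul j : ℂ) * w.1 j) he.symm

end Datum

namespace Datum

variable {n d : ℕ} (D : Datum n d)

/-! ## Facets and vertices of polytopes -/

/-- The linear functional `μ ↦ ⟨μ, X j⟩`. -/
def pairing (j : Fin d) : (Fin n → ℝ) →L[ℝ] ℝ :=
  LinearMap.toContinuousLinearMap
    { toFun := fun μ => μ ⬝ᵥ D.X j
      map_add' := fun μ ν => add_dotProduct μ ν _
      map_smul' := fun r μ => smul_dotProduct r μ _ }

theorem pairing_apply (j : Fin d) (μ : Fin n → ℝ) : D.pairing j μ = μ ⬝ᵥ D.X j := rfl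

theorem convex_polytope : Convex ℝ D.polytope := by
  have : D.polytope = ⋂ j, {μ | D.lam j ≤ D.pairing j μ} := by
    ext μ; simp [polytope, pairing_apply]
  rw [this]
  exact convex_iInter fun j => convex_halfSpace_ge (D.pairing j).isLinear _

theorem isExposed_facet (j : Fin d) : IsExposed ℝ D.polytope (D.facet j) := by
  rintro ⟨p, hp, hpj⟩
  -- Exposed faces are sets of maximizers, hence the sign. The given point `p` shows that the
  -- minimum `λ j` of the pairing is attained.
  refine ⟨-D.pairing j, Set.ext fun x => ⟨fun hx => ⟨hx.1, fun y hy => ?_⟩,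
    fun hx => ⟨hx.1, le_antisymm ?_ (hx.1 j)⟩⟩⟩
  · have h1 := hy j
    have h2 := hx.2
    simp only [neg_apply, pairing_apply]
    linarith
  · have := hx.2 p hp
    simp only [neg_apply, pairing_apply] at this
    linarith

theorem eventually_lt_pairing {j : Fin d} {c : Fin n → ℝ} (h : D.lam j < c ⬝ᵥ D.X j)
    (v : Fin n → ℝ) : ∀ᶠ t : ℝ in nhds 0, D.lam j < (c + t • v) ⬝ᵥ D.X j := by
  have hc : Continuous fun t : ℝ => D.pairing j (c + t • v) := by fun_prop
  refine hc.continuousAt.eventually_const_lt ?_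
  simpa [pairing_apply] using h

theorem eventually_mem_polytope {c : Fin n → ℝ} (h : ∀ j, D.lam j < c ⬝ᵥ D.X j)
    (v : Fin n → ℝ) : ∀ᶠ t : ℝ in nhds 0, c + t • v ∈ D.polytope :=
  (Filter.eventually_all.2 fun j => D.eventually_lt_pairing (h j) v).mono
    fun _ ht j => (ht j).le

/-- For a small `t ≠ 0`, `v` is `t⁻¹` times the difference of the points `c + t • v` and `c` of `s`.
Dimensions can thus be computed at one relatively interior point. -/
theorem mem_vectorSpan_of_eventually {s : Set (Fin n → ℝ)} {c v : Fin n → ℝ}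
    (h : ∀ᶠ t : ℝ in nhds 0, c + t • v ∈ s) : v ∈ vectorSpan ℝ s := by
  obtain ⟨t, ht, ht0⟩ := ((h.filter_mono nhdsWithin_le_nhds).and
    (self_mem_nhdsWithin : {0}ᶜ ∈ nhdsWithin (0 : ℝ) {0}ᶜ)).exists
  have hc : c ∈ s := by simpa using h.self_of_nhds
  have := Submodule.smul_mem _ t⁻¹ (vsub_mem_vectorSpan ℝ ht hc)
  rwa [vsub_eq_sub, add_sub_cancel_left, smul_smul, inv_mul_cancel₀ ht0, one_smul] at this

theorem vectorSpan_polytope {c : Fin n → ℝ} (h : ∀ j, D.lam j < c ⬝ᵥ D.X j) :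
    vectorSpan ℝ D.polytope = ⊤ :=
  eq_top_iff.2 fun v _ => mem_vectorSpan_of_eventually (D.eventually_mem_polytope h v)

/-- Near `c` only the `j`-th constraint is active, so there the facet coincides with its whole
hyperplane. -/
theorem vectorSpan_facet {j : Fin d} {c : Fin n → ℝ} (hc : c ⬝ᵥ D.X j = D.lam j)
    (h : ∀ k ≠ j, D.lam k < c ⬝ᵥ D.X k) :
    vectorSpan ℝ (D.facet j) = LinearMap.ker (D.pairing j).toLinearMap := by
  refine le_antisymm (Submodule.span_le.2 ?_) fun v hv => ?_
  · rintro _ ⟨x, hx, y, hy, rfl⟩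
    change D.pairing j (x - y) = 0
    rw [map_sub, pairing_apply, pairing_apply, hx.2, hy.2, sub_self]
  · have hv' : v ⬝ᵥ D.X j = 0 := hv
    refine mem_vectorSpan_of_eventually (c := c) ?_
    have he : ∀ᶠ t : ℝ in nhds 0, ∀ k, k ≠ j → D.lam k < (c + t • v) ⬝ᵥ D.X k := by
      refine Filter.eventually_all.2 fun k => ?_
      by_cases hk : k = j
      · exact Filter.Eventually.of_forall fun _ h => absurd hk h
      · exact (D.eventually_lt_pairing (h k hk) v).mono fun _ h _ => h
    refine he.mono fun t ht => ?_
    have hj : (c + t • v) ⬝ᵥ D.X j = D.lam j := by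
      rw [add_dotProduct, smul_dotProduct, hv', hc, smul_zero, add_zero]
    refine ⟨fun k => ?_, hj⟩
    by_cases hk : k = j
    · rw [hk, hj]
    · exact (ht k hk).le

theorem isFacet_facet {j : Fin d} {c : Fin n → ℝ} (hX : D.X j ≠ 0) (hc : c ⬝ᵥ D.X j = D.lam j)
    (h : ∀ k ≠ j, D.lam k < c ⬝ᵥ D.X k) : IsFacet D.polytope (D.facet j) := by
  refine ⟨D.isExposed_facet j, ⟨c, fun k => ?_, hc⟩, ?_⟩
  · by_cases hk : k = j
    · rw [hk, hc]
    · exact (h k hk).le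
  · have h0 : (D.pairing j).toLinearMap ≠ 0 := fun h0 => hX <| by
      rw [← dotProduct_self_eq_zero]
      exact LinearMap.congr_fun h0 (D.X j)
    rw [D.vectorSpan_facet hc h]
    simpa using Module.Dual.finrank_ker_add_one_of_ne_zero h0

/-- A nonempty convex subset of `Δ` that is contained in no `D.facet j` contains a point that
satisfies all inequalities strictly. -/
theorem exists_lt_of_not_subset_facet [NeZero d] {F : Set (Fin n → ℝ)} (hF : Convex ℝ F)
    (hFΔ : F ⊆ D.polytope) (h : ∀ j, ¬ F ⊆ D.facet j) :
    ∃ x ∈ F, ∀ j, D.lam j < x ⬝ᵥ D.X j := by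
  have h' : ∀ j, ∃ x ∈ F, D.lam j < x ⬝ᵥ D.X j := fun j => by
    obtain ⟨x, hx, hxj⟩ := Set.not_subset.1 (h j)
    exact ⟨x, hx, lt_of_le_of_ne (hFΔ hx j) fun he => hxj ⟨hFΔ hx, he.symm⟩⟩
  choose x hx hxj using h'
  have hd : (0 : ℝ) < d := Nat.cast_pos.2 (NeZero.pos d)
  have hsum : ∑ _j : Fin d, (1 / d : ℝ) = 1 := by simp [hd.ne']
  -- In the barycentre of the `x j`, the term `x k` makes the `k`-th inequality strict, and the
  -- others do not spoil it.
  refine ⟨∑ j, (1 / d : ℝ) • x j, hF.sum_mem (fun _ _ => by positivity) hsum fun j _ => hx j,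
    fun k => ?_⟩
  rw [← pairing_apply, map_sum]
  calc D.lam k = ∑ _j : Fin d, (1 / d : ℝ) * D.lam k := by rw [← Finset.sum_mul, hsum, one_mul]
    _ < ∑ j, D.pairing k ((1 / d : ℝ) • x j) := by
      refine Finset.sum_lt_sum (fun j _ => ?_) ⟨k, Finset.mem_univ _, ?_⟩
      · rw [map_smul, smul_eq_mul]
        exact mul_le_mul_of_nonneg_left (hFΔ (hx j) k) (by positivity)
      · rw [map_smul, smul_eq_mul]
        exact mul_lt_mul_of_pos_left (hxj k) (by positivity)

/-- If `F` lies in some `D.facet j`, the two have the same dimension, hence the same direction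
space; the functional exposing `F` is constant along it, so `F` is all of `D.facet j`. Otherwise `F`
contains an interior point of `Δ`. A functional with a maximum there vanishes, so `F = Δ`, whose
dimension is too large for a facet. -/
theorem exists_eq_facet [NeZero d] (hdim : ∀ j, IsFacet D.polytope (D.facet j))
    {F : Set (Fin n → ℝ)} (hF : IsFacet D.polytope F) : ∃ j, D.facet j = F := by
  obtain ⟨hexp, hne, hfin⟩ := hF
  obtain ⟨l, hl⟩ := hexp hne
  have hFΔ : F ⊆ D.polytope := fun x hx => (hl ▸ hx : x ∈ {x ∈ D.polytope | _}).1
  have hmax : ∀ x ∈ F, ∀ y ∈ D.polytope, l y ≤ l x :=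
    fun x hx => (hl ▸ hx : x ∈ {x ∈ D.polytope | ∀ y ∈ D.polytope, l y ≤ l x}).2
  by_cases hsub : ∃ j, F ⊆ D.facet j
  · obtain ⟨j, hj⟩ := hsub
    refine ⟨j, (Set.Subset.antisymm hj fun y hy => ?_).symm⟩
    have hspan : vectorSpan ℝ F = vectorSpan ℝ (D.facet j) :=
      Submodule.eq_of_le_of_finrank_eq (vectorSpan_mono ℝ hj) (by have := (hdim j).2.2; omega)
    have hker : vectorSpan ℝ F ≤ LinearMap.ker l.toLinearMap := by
      refine Submodule.span_le.2 ?_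
      rintro _ ⟨x, hx, y, hy, rfl⟩
      change l (x - y) = 0
      rw [map_sub, sub_eq_zero]
      exact le_antisymm (hmax y hy x (hFΔ hx)) (hmax x hx y (hFΔ hy))
    obtain ⟨x, hx⟩ := hne
    have hyx : l (y - x) = 0 := hker (hspan ▸ vsub_mem_vectorSpan ℝ hy (hj hx))
    rw [map_sub, sub_eq_zero] at hyx
    rw [hl]
    exact ⟨hy.1, fun w hw => hyx ▸ hmax x hx w hw⟩
  · rw [not_exists] at hsub
    obtain ⟨x, hx, hlt⟩ :=
      D.exists_lt_of_not_subset_facet (hexp.convex D.convex_polytope) hFΔ hsub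
    -- The maximizer `x` can be moved slightly in any direction `v` without leaving `Δ`.
    have hle : ∀ v, l v ≤ 0 := fun v => by
      obtain ⟨t, ht, ht0⟩ := (((D.eventually_mem_polytope hlt v).filter_mono
        nhdsWithin_le_nhds).and (self_mem_nhdsWithin : Set.Ioi 0 ∈ nhdsWithin (0 : ℝ) _)).exists
      have := hmax x hx _ ht
      rw [map_add, map_smul, smul_eq_mul] at this
      have h0 : t * l v ≤ t * 0 := by linarith
      exact le_of_mul_le_mul_left h0 ht0
    have hl0 : ∀ v, l v = 0 := fun v =>
      le_antisymm (hle v) (by have := hle (-v); rw [map_neg] at this; linarith)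
    have hFeq : F = D.polytope := by
      rw [hl]
      exact Set.sep_eq_self_iff_mem_true.2 fun y _ w _ => by rw [hl0, hl0]
    rw [hFeq, D.vectorSpan_polytope hlt, finrank_top, Module.finrank_fin_fun] at hfin
    omega

theorem span_eq_top_of_le_closure {s : Set (Fin n → ℝ)} (h : D.Q ≤ AddSubgroup.closure s) :
    Submodule.span ℝ s = ⊤ := by
  obtain ⟨S, -, hS, hQ⟩ := D.isQuasilattice
  rw [← top_le_iff, ← hS, Submodule.span_le]
  intro x hx
  have hle : AddSubgroup.closure s ≤ (Submodule.span ℝ s).toAddSubgroup :=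
    (AddSubgroup.closure_le _).2 Submodule.subset_span
  exact hle (h (hQ ▸ AddSubgroup.subset_closure hx))

/-- Delzant's condition, for the convex hull of finitely many points at each of which `n` of the
inequalities are equalities, with normals that generate `Q`. -/
theorem isDelzant_of [NeZero d] {S : Set (Fin n → ℝ)} (hS : S.Finite)
    (hΔ : D.polytope = convexHull ℝ S) (hlam : ∀ j, D.lam j < 0)
    (hc : ∀ j, ∃ c : Fin n → ℝ, c ⬝ᵥ D.X j = D.lam j ∧ ∀ k ≠ j, D.lam k < c ⬝ᵥ D.X k)
    (hv : ∀ v ∈ S, ∃ f : Fin n → Fin d, Function.Injective f ∧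
      (∀ j, v ⬝ᵥ D.X j = D.lam j ↔ j ∈ Set.range f) ∧
      D.Q ≤ AddSubgroup.closure (Set.range (D.X ∘ f))) : D.IsDelzant := by
  have hX : ∀ j, D.X j ≠ 0 := fun j h => by
    obtain ⟨c, hcj, -⟩ := hc j
    have := hlam j
    rw [h, dotProduct_zero] at hcj
    linarith
  have hfacet : ∀ j, IsFacet D.polytope (D.facet j) := fun j => by
    obtain ⟨c, hcj, hck⟩ := hc j
    exact D.isFacet_facet (hX j) hcj hck
  -- The point `c` chosen for `j` satisfies every other inequality strictly, so it lies on no other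
  -- facet.
  have hinj : Function.Injective D.facet := fun j k hjk => by
    by_contra hne
    obtain ⟨c, hcj, hck⟩ := hc j
    have hmem : c ∈ D.facet j := ⟨fun i => by
      by_cases hi : i = j
      · rw [hi, hcj]
      · exact (hck i hi).le, hcj⟩
    rw [hjk] at hmem
    exact (hck k (Ne.symm hne)).ne' hmem.2
  -- This is why the hypothesis `hv` on `S` covers all vertices.
  have hext : D.polytope.extremePoints ℝ ⊆ S := hΔ ▸ extremePoints_convexHull_subset
  refine ⟨⟨⟨⟨S, hS, hΔ⟩, ?_, fun v hvΔ => ?_⟩, fun j _ => hfacet j, hinj.injOn, fun F hF => ?_⟩,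
    fun v hvΔ => ?_⟩
  · rw [D.vectorSpan_polytope (c := 0) (by simpa using hlam), finrank_top,
      Module.finrank_fin_fun]
  · obtain ⟨f, hf, hact, -⟩ := hv v (hext hvΔ)
    have : {F | IsFacet D.polytope F ∧ v ∈ F} = (D.facet ∘ f) '' Set.univ := by
      ext F
      constructor
      · rintro ⟨hF, hvF⟩
        obtain ⟨j, rfl⟩ := D.exists_eq_facet hfacet hF
        obtain ⟨i, rfl⟩ := (hact j).1 hvF.2
        exact ⟨i, trivial, rfl⟩
      · rintro ⟨i, -, rfl⟩
        exact ⟨hfacet _, hvΔ.1, (hact _).2 ⟨i, rfl⟩⟩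
    rw [this, Set.ncard_image_of_injective _ (hinj.comp hf), Set.ncard_univ, Nat.card_fin]
  · obtain ⟨j, rfl⟩ := D.exists_eq_facet hfacet hF
    exact ⟨j, trivial, rfl⟩
  · obtain ⟨f, hf, hact, hQ⟩ := hv v (hext hvΔ)
    -- Generating `Q` over `ℤ` implies spanning `ℝⁿ`, and `n` spanning vectors are independent.
    have hli : LinearIndependent ℝ (D.X ∘ f) :=
      linearIndependent_of_top_le_span_of_card_eq_finrank
        (D.span_eq_top_of_le_closure hQ).ge (by simp)
    have himage : D.X '' {j | v ⬝ᵥ D.X j = D.lam j} = Set.range (D.X ∘ f) := by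
      rw [Set.range_comp]
      exact congrArg _ (Set.ext hact)
    refine ⟨?_, le_antisymm ((AddSubgroup.closure_le _).2 ?_) (himage ▸ hQ)⟩
    · choose g hg using fun j : {j : Fin d // v ⬝ᵥ D.X j = D.lam j} => (hact j).1 j.2
      have hgi : Function.Injective g := fun j k h => Subtype.ext (by rw [← hg, h, hg])
      convert hli.comp g hgi using 2 with j
      simp [hg]
    · rintro _ ⟨j, -, rfl⟩
      exact D.X_mem j

end Datum

/-! ## The polytopes of the tetrahedron and the cube -/

theorem dotProduct_Y (μ : Fin 3 → ℝ) (j : Fin 4) :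
    μ ⬝ᵥ Y j = ![μ 0 + μ 1 + μ 2, μ 0 - μ 1 - μ 2, -μ 0 + μ 1 - μ 2, -μ 0 - μ 1 + μ 2] j := by
  fin_cases j <;> simp [Y, dotProduct, Fin.sum_univ_three] <;> ring

/-- The `Y j` serve both as normals and as vertices. By this Gram matrix the vertex `Y k` lies on
every facet except the `k`-th, which is opposite to it. -/
theorem Y_dotProduct_Y (j k : Fin 4) : Y j ⬝ᵥ Y k = if j = k then 3 else -1 := by
  rw [dotProduct_Y]
  fin_cases j <;> fin_cases k <;> simp [Y] <;> norm_num

theorem mem_polytope_tetrahedron {μ : Fin 3 → ℝ} :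
    μ ∈ tetrahedron.polytope ↔ ∀ j, -1 ≤ μ ⬝ᵥ Y j := Iff.rfl

theorem Y_mem_polytope (j : Fin 4) : Y j ∈ tetrahedron.polytope := by
  rw [mem_polytope_tetrahedron]
  intro k
  rw [Y_dotProduct_Y]
  split_ifs <;> norm_num

theorem polytope_tetrahedron : tetrahedron.polytope = convexHull ℝ (Set.range Y) := by
  refine Set.Subset.antisymm (fun μ hμ => ?_) (convexHull_min ?_ tetrahedron.convex_polytope)
  · rw [mem_polytope_tetrahedron] at hμ
    -- The numbers `(1 + ⟨μ, Y j⟩) / 4` are the barycentric coordinates of `μ`: they are nonnegative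
    -- by the inequalities, sum to `1` because the `Y j` sum to `0`, and represent `μ` because `∑
    -- ⟨μ, Y j⟩ Y j = 4 μ`.
    have hsum : ∑ j, (1 + μ ⬝ᵥ Y j) / 4 = 1 := by
      simp only [dotProduct_Y]
      simp [Fin.sum_univ_four]; ring
    have hμ' : μ = ∑ j, ((1 + μ ⬝ᵥ Y j) / 4) • Y j := by
      simp only [dotProduct_Y]
      ext i
      fin_cases i <;> simp [Fin.sum_univ_four, Y] <;> ring
    rw [hμ']
    exact (convex_convexHull ℝ _).sum_mem (fun j _ => by linarith [hμ j]) hsum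
      fun j _ => subset_convexHull ℝ _ ⟨j, rfl⟩
  · rintro _ ⟨j, rfl⟩
    exact Y_mem_polytope j

theorem sum_Y : ∑ j, Y j = 0 := by
  ext i
  fin_cases i <;> simp [Fin.sum_univ_four, Y]

theorem L_le_intLattice : L ≤ intLattice 3 := by
  refine (AddSubgroup.closure_le _).2 ?_
  rintro _ ⟨j, rfl⟩
  refine ⟨(![![1, 1, 1], ![1, -1, -1], ![-1, 1, -1], ![-1, -1, 1]] : Fin 4 → Fin 3 → ℤ) j, ?_⟩
  ext i
  fin_cases j <;> fin_cases i <;> simp [Y]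

theorem isDelzant_tetrahedron : tetrahedron.IsDelzant := by
  -- The point `-Y j / 3` is the centre of the `j`-th facet; it pairs to `-1` with `Y j` and to `1 /
  -- 3` with the other normals.
  refine tetrahedron.isDelzant_of (Set.finite_range Y) polytope_tetrahedron
    (fun _ => neg_one_lt_zero) (fun j => ⟨(-1 / 3 : ℝ) • Y j, ?_, fun k hk => ?_⟩) ?_
  · change _ ⬝ᵥ Y j = -1
    rw [smul_dotProduct, Y_dotProduct_Y, if_pos rfl]
    norm_num
  · change -1 < _ ⬝ᵥ Y k
    rw [smul_dotProduct, Y_dotProduct_Y, if_neg hk.symm]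
    norm_num
  · rintro _ ⟨k, rfl⟩
    refine ⟨k.succAbove, Fin.succAbove_right_injective, fun j => ?_,
      (AddSubgroup.closure_le _).2 ?_⟩
    · change Y k ⬝ᵥ Y j = -1 ↔ _
      rw [Y_dotProduct_Y, Fin.range_succAbove]
      split_ifs with h
      · simp [h]; norm_num
      · simp [Ne.symm h]
    · have hi : ∀ i, Y (k.succAbove i) ∈ AddSubgroup.closure (Set.range (Y ∘ k.succAbove)) :=
        fun i => AddSubgroup.subset_closure ⟨i, rfl⟩
      rintro _ ⟨j, rfl⟩
      refine Fin.succAboveCases k ?_ hi j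
      -- The normal missing at the vertex is minus the sum of the other three, so these already
      -- generate `L`.
      have := sum_Y
      rw [Fin.sum_univ_succAbove _ k] at this
      rw [eq_neg_of_add_eq_zero_left this]
      exact neg_mem (AddSubgroup.sum_mem _ fun i _ => hi i)

theorem dotProduct_cubeNormal (μ : Fin 3 → ℝ) (j : Fin 6) :
    μ ⬝ᵥ cubeNormal j = ![μ 0, -μ 0, μ 1, -μ 1, μ 2, -μ 2] j := by
  fin_cases j <;> simp [cubeNormal]

theorem mem_polytope_cube {a : ℝ} {μ : Fin 3 → ℝ} :
    μ ∈ (cube a).polytope ↔ ∀ i, -a ≤ μ i ∧ μ i ≤ a := by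
  change (∀ j, -a ≤ μ ⬝ᵥ cubeNormal j) ↔ _
  simp only [dotProduct_cubeNormal]
  constructor
  · intro h i
    have h0 := h 0; have h1 := h 1; have h2 := h 2; have h3 := h 3; have h4 := h 4; have h5 := h 5
    simp at h0 h1 h2 h3 h4 h5
    fin_cases i <;> exact ⟨by assumption, by assumption⟩
  · intro h j
    have h0 := h 0; have h1 := h 1; have h2 := h 2
    fin_cases j <;> simp <;> linarith

theorem polytope_cube {a : ℝ} (ha : 0 < a) :
    (cube a).polytope = convexHull ℝ {v | ∀ i, v i = a ∨ v i = -a} := by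
  -- The vertex set is a product, and convex hulls commute with products; each factor becomes the
  -- segment `[-a, a]`.
  have h : {v : Fin 3 → ℝ | ∀ i, v i = a ∨ v i = -a} = Set.univ.pi fun _ => {-a, a} := by
    ext v; simp [or_comm]
  rw [h, convexHull_pi]
  ext μ
  simp only [mem_polytope_cube, convexHull_pair, segment_eq_Icc (neg_le_self ha.le),
    Set.mem_univ_pi, Set.mem_Icc]

/-- The index of the facet through the vertex with `i`-th coordinate `x` that is orthogonal to
`e_i`. -/
def cubeIndex (a : ℝ) (v : Fin 3 → ℝ) (i : Fin 3) : Fin 6 :=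
  if v i = a then ![1, 3, 5] i else ![0, 2, 4] i

theorem isDelzant_cube {a : ℝ} (ha : 0 < a) : (cube a).IsDelzant := by
  -- The centre of the `j`-th facet is `-a` times its normal: it pairs to `-a`, `a` and `0` with
  -- that normal, its opposite and the remaining ones.
  refine (cube a).isDelzant_of (S := {v | ∀ i, v i = a ∨ v i = -a}) ?_ (polytope_cube ha)
    (fun _ => neg_lt_zero.2 ha) (fun j => ⟨(-a) • cubeNormal j, ?_, fun k hk => ?_⟩) ?_
  · have : {v : Fin 3 → ℝ | ∀ i, v i = a ∨ v i = -a} = Set.univ.pi fun _ => {a, -a} := by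
      ext v; simp
    rw [this]
    exact Set.Finite.pi fun _ => Set.toFinite _
  · change _ ⬝ᵥ cubeNormal j = -a
    rw [dotProduct_cubeNormal]
    fin_cases j <;> simp [cubeNormal]
  · change -a < _ ⬝ᵥ cubeNormal k
    rw [dotProduct_cubeNormal]
    fin_cases j <;> fin_cases k <;> first | exact absurd rfl hk | (simp [cubeNormal]; try linarith)
  · intro v hv
    have hne : -a ≠ a := by linarith
    refine ⟨cubeIndex a v, ?_, fun j => ?_, ?_⟩
    · intro i k h
      fin_cases i <;> fin_cases k <;> simp [cubeIndex] at h ⊢ <;> split_ifs at h <;> simp at h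
    · change v ⬝ᵥ cubeNormal j = -a ↔ _
      rw [dotProduct_cubeNormal]
      rcases hv 0 with h0 | h0 <;> rcases hv 1 with h1 | h1 <;> rcases hv 2 with h2 | h2 <;>
        fin_cases j <;> simp [cubeIndex, Fin.exists_fin_succ, h0, h1, h2, hne, hne.symm]
    -- The normals at a vertex are `±e₁, ±e₂, ±e₃`, and signs do not affect the group generated.
    · have hi : ∀ i, (Pi.single i 1 : Fin 3 → ℝ) ∈
          AddSubgroup.closure (Set.range (cubeNormal ∘ cubeIndex a v)) := by
        intro i
        have hmem : cubeNormal (cubeIndex a v i) ∈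
          AddSubgroup.closure (Set.range (cubeNormal ∘ cubeIndex a v)) :=
          AddSubgroup.subset_closure ⟨i, rfl⟩
        have h : cubeNormal (cubeIndex a v i) = Pi.single i 1 ∨
            -cubeNormal (cubeIndex a v i) = Pi.single i 1 := by
          unfold cubeIndex
          split_ifs <;> fin_cases i <;> simp [cubeNormal]
        rcases h with h | h
        · exact h ▸ hmem
        · exact h ▸ neg_mem hmem
      rintro _ ⟨m, rfl⟩
      have : ((Int.castAddHom ℝ).compLeft (Fin 3)) m =
          ∑ i, m i • (Pi.single i 1 : Fin 3 → ℝ) := by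
        ext k
        simp [Finset.sum_apply, Pi.single_apply]
      rw [this]
      exact AddSubgroup.sum_mem _ fun i _ => AddSubgroup.zsmul_mem _ (hi i) _

theorem closure_range_Y : AddSubgroup.closure (Set.range tetrahedron.X) = tetrahedron.Q := rfl

theorem closure_range_cubeNormal (a : ℝ) :
    AddSubgroup.closure (Set.range (cube a).X) = (cube a).Q := by
  refine le_antisymm ((AddSubgroup.closure_le _).2 ?_) ?_
  · rintro _ ⟨j, rfl⟩
    exact (cube a).X_mem j
  · rintro _ ⟨m, rfl⟩
    have : ((Int.castAddHom ℝ).compLeft (Fin 3)) m =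
        m 0 • cubeNormal 0 + m 1 • cubeNormal 2 + m 2 • cubeNormal 4 := by
      ext k
      fin_cases k <;> simp [cubeNormal]
    rw [this]
    have h : ∀ j, cubeNormal j ∈ AddSubgroup.closure (Set.range (cube a).X) :=
      fun j => AddSubgroup.subset_closure ⟨j, rfl⟩
    exact add_mem (add_mem (zsmul_mem (h 0) _) (zsmul_mem (h 2) _)) (zsmul_mem (h 4) _)

/-! ## Kernels, level sets and open sets of the tetrahedron and the cube -/

theorem piR_tetrahedron_eq_zero (η : Fin 4 → ℝ) :
    tetrahedron.piR η = 0 ↔ ∃ c : Unit → ℝ, η = c ∘ fun _ => () := by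
  rw [Datum.piR_apply]
  change ∑ j, η j • Y j = 0 ↔ _
  constructor
  · intro h
    have h0 := congrFun h 0; have h1 := congrFun h 1; have h2 := congrFun h 2
    simp [Fin.sum_univ_four, Y] at h0 h1 h2
    refine ⟨fun _ => η 0, ?_⟩
    ext j
    fin_cases j <;> simp <;> linarith
  · rintro ⟨c, rfl⟩
    simp [← Finset.smul_sum, sum_Y]

theorem piC_tetrahedron_eq_zero (η : Fin 4 → ℂ) :
    tetrahedron.piC η = 0 ↔ ∃ c : Unit → ℂ, η = c ∘ fun _ => () := by
  have hX : tetrahedron.X = Y := rfl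
  constructor
  · intro h
    have h0 := congrFun h 0; have h1 := congrFun h 1; have h2 := congrFun h 2
    simp [Datum.piC_apply, hX, Fin.sum_univ_four, Y] at h0 h1 h2
    refine ⟨fun _ => η 0, ?_⟩
    ext j
    fin_cases j <;> simp
    · linear_combination (-1 / 2) * (h1 + h2)
    · linear_combination (-1 / 2) * (h0 + h2)
    · linear_combination (-1 / 2) * (h0 + h1)
  · rintro ⟨c, rfl⟩
    ext i
    fin_cases i <;> simp [Datum.piC_apply, hX, Fin.sum_univ_four, Y]

/-- The coordinate of `ℝ³` to which the `j`-th facet of the cube is orthogonal. -/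
def cubeAxis : Fin 6 → Fin 3 := ![0, 0, 1, 1, 2, 2]

theorem piR_cube (a : ℝ) (η : Fin 6 → ℝ) :
    (cube a).piR η = ![η 0 - η 1, η 2 - η 3, η 4 - η 5] := by
  have hX : (cube a).X = cubeNormal := rfl
  rw [Datum.piR_apply, hX]
  ext i
  fin_cases i <;> simp [Fin.sum_univ_succ, cubeNormal] <;> ring

theorem piC_cube (a : ℝ) (η : Fin 6 → ℂ) :
    (cube a).piC η = ![η 0 - η 1, η 2 - η 3, η 4 - η 5] := by
  have hX : (cube a).X = cubeNormal := rfl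
  ext i
  rw [Datum.piC_apply, hX]
  fin_cases i <;> simp [Fin.sum_univ_succ, cubeNormal] <;> ring

theorem exists_eq_comp_cubeAxis {R : Type*} (η : Fin 6 → R) :
    (∃ c : Fin 3 → R, η = c ∘ cubeAxis) ↔ η 0 = η 1 ∧ η 2 = η 3 ∧ η 4 = η 5 := by
  constructor
  · rintro ⟨c, rfl⟩
    simp [cubeAxis]
  · rintro ⟨h0, h1, h2⟩
    refine ⟨![η 0, η 2, η 4], ?_⟩
    ext j
    fin_cases j <;> simp [cubeAxis, h0, h1, h2]

theorem piR_cube_eq_zero (a : ℝ) (η : Fin 6 → ℝ) :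
    (cube a).piR η = 0 ↔ ∃ c : Fin 3 → ℝ, η = c ∘ cubeAxis := by
  rw [exists_eq_comp_cubeAxis, piR_cube]
  simp [sub_eq_zero]

theorem piC_cube_eq_zero (a : ℝ) (η : Fin 6 → ℂ) :
    (cube a).piC η = 0 ↔ ∃ c : Fin 3 → ℂ, η = c ∘ cubeAxis := by
  rw [exists_eq_comp_cubeAxis, piC_cube]
  simp [sub_eq_zero]

/-- Since `ker π` is spanned by `(1, 1, 1, 1)`, the only condition is `∑ (|z j|² - 1) = 0`. -/
theorem levelSet_tetrahedron :
    tetrahedron.levelSet = Metric.sphere (0 : EuclideanSpace ℂ (Fin 4)) 2 := by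
  ext z
  rw [Datum.mem_levelSet, mem_sphere_zero_iff_norm, EuclideanSpace.norm_eq,
    Real.sqrt_eq_iff_mul_self_eq (by positivity) (by norm_num)]
  have hl : ∀ j, tetrahedron.lam j = -1 := fun _ => rfl
  simp only [piR_tetrahedron_eq_zero, Fin.sum_univ_four, hl]
  constructor
  · intro h
    have := h (fun _ => 1) ⟨fun _ => 1, rfl⟩
    linarith
  · rintro h _ ⟨c, rfl⟩
    simp only [Function.comp_apply]
    linear_combination c () * h

theorem levelSet_cube (a : ℝ) : (cube a).levelSet = {z | ‖z 0‖ ^ 2 + ‖z 1‖ ^ 2 = 2 * a ∧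
    ‖z 2‖ ^ 2 + ‖z 3‖ ^ 2 = 2 * a ∧ ‖z 4‖ ^ 2 + ‖z 5‖ ^ 2 = 2 * a} := by
  ext z
  have hl : ∀ j, (cube a).lam j = -a := fun _ => rfl
  simp only [Datum.mem_levelSet, piR_cube_eq_zero, Fin.sum_univ_six, hl]
  constructor
  · intro h
    -- The indicator vectors of the three axes form a basis of `ker π`, with one equation each.
    have h0 := h _ ⟨![1, 0, 0], rfl⟩
    have h1 := h _ ⟨![0, 1, 0], rfl⟩
    have h2 := h _ ⟨![0, 0, 1], rfl⟩
    simp [cubeAxis] at h0 h1 h2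
    exact ⟨by linarith, by linarith, by linarith⟩
  · rintro ⟨h0, h1, h2⟩ _ ⟨c, rfl⟩
    simp [cubeAxis]
    linear_combination c 0 * h0 + c 1 * h1 + c 2 * h2

/-- No point lies on all four facets, since its pairings with the normals sum to `0` rather than
`-4`. If `z k ≠ 0`, the vertex `Y k` lies on all the other facets. -/
theorem openSet_tetrahedron : tetrahedron.openSet = {z | z ≠ 0} := by
  ext z
  rw [Datum.mem_openSet]
  change (∃ μ ∈ tetrahedron.polytope, ∀ j, z j = 0 → μ ⬝ᵥ Y j = -1) ↔ z ≠ 0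
  constructor
  · rintro ⟨μ, -, h⟩ rfl
    have hs : ∑ j, μ ⬝ᵥ Y j = 0 := by rw [← dotProduct_sum, sum_Y, dotProduct_zero]
    rw [Finset.sum_congr rfl fun j _ => h j rfl] at hs
    norm_num at hs
  · intro hz
    obtain ⟨k, hk⟩ : ∃ k, z k ≠ 0 := by
      by_contra! h
      exact hz (by ext k; exact h k)
    refine ⟨Y k, Y_mem_polytope k, fun j hj => ?_⟩
    rw [Y_dotProduct_Y, if_neg]
    rintro rfl
    exact hk hj

theorem openSet_cube {a : ℝ} (ha : 0 < a) : (cube a).openSet =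
    {z | (z 0 ≠ 0 ∨ z 1 ≠ 0) ∧ (z 2 ≠ 0 ∨ z 3 ≠ 0) ∧ (z 4 ≠ 0 ∨ z 5 ≠ 0)} := by
  ext z
  rw [Datum.mem_openSet]
  change (∃ μ ∈ (cube a).polytope, ∀ j, z j = 0 → μ ⬝ᵥ cubeNormal j = -a) ↔ _
  simp only [dotProduct_cubeNormal]
  constructor
  · rintro ⟨μ, -, h⟩
    refine ⟨?_, ?_, ?_⟩ <;> by_contra! hz
    · have h1 := h 0 hz.1
      have h2 := h 1 hz.2
      simp at h1 h2
      linarith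
    · have h1 := h 2 hz.1
      have h2 := h 3 hz.2
      simp at h1 h2
      linarith
    · have h1 := h 4 hz.1
      have h2 := h 5 hz.2
      simp at h1 h2
      linarith
  · rintro ⟨h0, h1, h2⟩
    -- The axes are independent, and on one axis only opposite facets exclude each other. The
    -- endpoint of `[-a, a]` is chosen according to which coordinate may vanish, so `μ` is a vertex.
    have key : ∀ x y : ℂ, x ≠ 0 ∨ y ≠ 0 → ∃ m : ℝ, (-a ≤ m ∧ m ≤ a) ∧ (x = 0 → m = -a) ∧
        (y = 0 → -m = -a) := by
      intro x y h
      by_cases hx : x = 0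
      · exact ⟨-a, ⟨le_rfl, by linarith⟩, fun _ => rfl, fun hy => by simp [hx, hy] at h⟩
      · exact ⟨a, ⟨by linarith, le_rfl⟩, fun h => absurd h hx, fun _ => rfl⟩
    obtain ⟨m0, hm0, hx0, hy0⟩ := key _ _ h0
    obtain ⟨m1, hm1, hx1, hy1⟩ := key _ _ h1
    obtain ⟨m2, hm2, hx2, hy2⟩ := key _ _ h2
    refine ⟨![m0, m1, m2], mem_polytope_cube.2 fun i => ?_, fun j => ?_⟩
    · fin_cases i <;> assumption
    · fin_cases j <;> assumption

/-! ## The groups of the tetrahedron and the cube -/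

theorem mem_N_tetrahedron (t : Torus 4) : t ∈ tetrahedron.N ↔
    ∃ s : Unit → Circle, expT 4 t = Additive.ofMul (s ∘ fun _ => ()) :=
  tetrahedron.mem_N_iff_exists_comp closure_range_Y _ piR_tetrahedron_eq_zero t

theorem mem_NC_tetrahedron (t : TorusC 4) : t ∈ tetrahedron.NC ↔
    ∃ s : Unit → ℂˣ, expTC 4 t = Additive.ofMul (s ∘ fun _ => ()) :=
  tetrahedron.mem_NC_iff_exists_comp closure_range_Y _ piC_tetrahedron_eq_zero t

theorem mem_N_cube (a : ℝ) (t : Torus 6) : t ∈ (cube a).N ↔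
    ∃ s : Fin 3 → Circle, expT 6 t = Additive.ofMul (s ∘ cubeAxis) :=
  (cube a).mem_N_iff_exists_comp (closure_range_cubeNormal a) _ (piR_cube_eq_zero a) t

theorem mem_NC_cube (a : ℝ) (t : TorusC 6) : t ∈ (cube a).NC ↔
    ∃ s : Fin 3 → ℂˣ, expTC 6 t = Additive.ofMul (s ∘ cubeAxis) :=
  (cube a).mem_NC_iff_exists_comp (closure_range_cubeNormal a) _ (piC_cube_eq_zero a) t

theorem exists_equiv_N_tetrahedron : ∃ e : Additive Circle ≃ₜ+ tetrahedron.N,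
    ∀ s, expT 4 (e s) = Additive.ofMul fun _ => s.toMul :=
  exists_continuousAddEquiv (expTEquiv 4) tetrahedron.N
    (φ := { toFun := fun s => Additive.ofMul fun _ => s.toMul
            map_zero' := rfl
            map_add' := fun _ _ => rfl })
    (continuous_ofMul.comp (continuous_pi fun _ => continuous_toMul))
    (fun s => Additive.ofMul (s.toMul 0))
    (continuous_ofMul.comp ((continuous_apply 0).comp continuous_toMul)) (fun _ => rfl)
    fun t => (mem_N_tetrahedron t).trans
      ⟨fun ⟨s, hs⟩ => ⟨Additive.ofMul (s ()), hs⟩, fun ⟨g, hg⟩ => ⟨fun _ => g.toMul, hg⟩⟩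

theorem exists_equiv_NC_tetrahedron : ∃ e : Additive ℂˣ ≃ₜ+ tetrahedron.NC,
    ∀ s, expTC 4 (e s) = Additive.ofMul fun _ => s.toMul :=
  exists_continuousAddEquiv (expTCEquiv 4) tetrahedron.NC
    (φ := { toFun := fun s => Additive.ofMul fun _ => s.toMul
            map_zero' := rfl
            map_add' := fun _ _ => rfl })
    (continuous_ofMul.comp (continuous_pi fun _ => continuous_toMul))
    (fun s => Additive.ofMul (s.toMul 0))
    (continuous_ofMul.comp ((continuous_apply 0).comp continuous_toMul)) (fun _ => rfl)
    fun t => (mem_NC_tetrahedron t).trans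
      ⟨fun ⟨s, hs⟩ => ⟨Additive.ofMul (s ()), hs⟩, fun ⟨g, hg⟩ => ⟨fun _ => g.toMul, hg⟩⟩

theorem comp_cubeAxis {G : Type*} (s : Fin 3 → G) :
    s ∘ cubeAxis = ![s 0, s 0, s 1, s 1, s 2, s 2] := by
  ext j
  fin_cases j <;> rfl

theorem exists_equiv_N_cube (a : ℝ) : ∃ e : Additive (Fin 3 → Circle) ≃ₜ+ (cube a).N,
    ∀ s, expT 6 (e s) = Additive.ofMul
      ![s.toMul 0, s.toMul 0, s.toMul 1, s.toMul 1, s.toMul 2, s.toMul 2] := by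
  obtain ⟨e, he⟩ := exists_continuousAddEquiv (expTEquiv 6) (cube a).N
    (φ := { toFun := fun s : Additive (Fin 3 → Circle) => Additive.ofMul (s.toMul ∘ cubeAxis)
            map_zero' := rfl
            map_add' := fun _ _ => rfl })
    (continuous_ofMul.comp (continuous_pi fun _ => (continuous_apply _).comp continuous_toMul))
    -- The continuous left inverse reads off the first coordinate of each pair.
    (fun s => Additive.ofMul (s.toMul ∘ ![0, 2, 4]))
    (continuous_ofMul.comp (continuous_pi fun _ => (continuous_apply _).comp continuous_toMul))
    (fun s => by
      refine congrArg Additive.ofMul (funext fun i => ?_)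
      fin_cases i <;> rfl)
    fun t => (mem_N_cube a t).trans
      ⟨fun ⟨s, hs⟩ => ⟨Additive.ofMul s, hs⟩, fun ⟨g, hg⟩ => ⟨g.toMul, hg⟩⟩
  exact ⟨e, fun s => (he s).trans (congrArg Additive.ofMul (comp_cubeAxis s.toMul))⟩

theorem exists_equiv_NC_cube (a : ℝ) : ∃ e : Additive (Fin 3 → ℂˣ) ≃ₜ+ (cube a).NC,
    ∀ s, expTC 6 (e s) = Additive.ofMul
      ![s.toMul 0, s.toMul 0, s.toMul 1, s.toMul 1, s.toMul 2, s.toMul 2] := by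
  obtain ⟨e, he⟩ := exists_continuousAddEquiv (expTCEquiv 6) (cube a).NC
    (φ := { toFun := fun s : Additive (Fin 3 → ℂˣ) => Additive.ofMul (s.toMul ∘ cubeAxis)
            map_zero' := rfl
            map_add' := fun _ _ => rfl })
    (continuous_ofMul.comp (continuous_pi fun _ => (continuous_apply _).comp continuous_toMul))
    (fun s => Additive.ofMul (s.toMul ∘ ![0, 2, 4]))
    (continuous_ofMul.comp (continuous_pi fun _ => (continuous_apply _).comp continuous_toMul))
    (fun s => by
      refine congrArg Additive.ofMul (funext fun i => ?_)
      fin_cases i <;> rfl)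
    fun t => (mem_NC_cube a t).trans
      ⟨fun ⟨s, hs⟩ => ⟨Additive.ofMul s, hs⟩, fun ⟨g, hg⟩ => ⟨g.toMul, hg⟩⟩
  exact ⟨e, fun s => (he s).trans (congrArg Additive.ofMul (comp_cubeAxis s.toMul))⟩

/-! ## Quotients by the fibres of a map with local sections -/

/-- A continuous map with continuous local sections identifies the quotient by its fibres with its
target. -/
theorem exists_homeomorph_of_local_sections {E Y : Type*} [TopologicalSpace E]
    [TopologicalSpace Y] {P : Set E} (S : Setoid P) {f : P → Y} (hf : Continuous f)
    (hS : ∀ z w, S z w ↔ f z = f w)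
    (hs : ∀ y, ∃ (V : Set Y) (s : Y → E), IsOpen V ∧ y ∈ V ∧ ContinuousOn s V ∧
      ∀ x ∈ V, ∃ hx : s x ∈ P, f ⟨s x, hx⟩ = x) :
    ∃ F : Quotient S ≃ₜ Y, ∀ z, F (Quotient.mk S z) = f z := by
  -- It remains to see that `f` is a quotient map: surjectivity and the openness criterion are both
  -- local on the target and follow from the sections.
  obtain rfl : S = Setoid.ker f := Setoid.ext hS
  have hq : Topology.IsQuotientMap f := by
    rw [Topology.isQuotientMap_iff, Topology.isCoinducing_iff, and_comm]
    refine ⟨fun y => ?_, fun U => ⟨fun hU => ?_, fun hU => hU.preimage hf⟩⟩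
    · obtain ⟨V, s, -, hy, -, h⟩ := hs y
      exact ⟨_, (h y hy).2⟩
    · rw [isOpen_iff_mem_nhds]
      intro y hy
      obtain ⟨V, s, hV, hyV, hsV, h⟩ := hs y
      have hc : Continuous fun x : V => (⟨s x, (h x x.2).1⟩ : P) :=
        (continuousOn_iff_continuous_domRestrict.1 hsV).subtype_mk _
      have ho : IsOpen ((↑) ⁻¹' U : Set V) := by
        -- Since `f ∘ s` is the identity on `V`, the part of `U` in `V` is the preimage under `s` of
        -- the open set `f ⁻¹' U`.
        have : ((↑) ⁻¹' U : Set V) = (fun x : V => (⟨s x, (h x x.2).1⟩ : P)) ⁻¹' (f ⁻¹' U) := by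
          ext x
          simp only [Set.mem_preimage]
          rw [(h x x.2).2]
        rw [this]
        exact hU.preimage hc
      have := hV.isOpenMap_subtype_val _ ho
      refine Filter.mem_of_superset (this.mem_nhds ⟨⟨y, hyV⟩, hy, rfl⟩) ?_
      rintro _ ⟨x, hx, rfl⟩
      exact hx
  exact ⟨Topology.IsQuotientMap.homeomorph (f := ⟨f, hf⟩) hq, fun z => rfl⟩

/-! ## Holomorphic maps to and from projective space -/

namespace CP

open Classical in
/-- The projection to projective space, extended by an arbitrary value at the origin. -/
def projExt {n : ℕ} (v : EuclideanSpace ℂ (Fin (n + 1))) : CP n :=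
  if h : v ≠ 0 then mk v h else affineInv 0 0

theorem projExt_of_ne {n : ℕ} {v : EuclideanSpace ℂ (Fin (n + 1))} (h : v ≠ 0) :
    projExt v = mk v h := dif_pos h

theorem continuousOn_projExt {n : ℕ} :
    ContinuousOn (projExt (n := n)) {v | v ≠ 0} := by
  rw [continuousOn_iff_continuous_domRestrict]
  have : Set.domRestrict {v | v ≠ 0} (projExt (n := n)) = proj := funext fun v => projExt_of_ne v.2
  rw [this]
  exact (isQuotientMap_proj n).continuous

theorem isOpen_ne_zero {n : ℕ} : IsOpen {v : EuclideanSpace ℂ (Fin n) | v ≠ 0} :=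
  isOpen_ne

/-- In an affine chart the projection is given by the quotients `w k / w i`, which are analytic
where `w i ≠ 0`. -/
theorem contMDiffOn_projExt {n : ℕ} :
    ContMDiffOn 𝓘(ℂ, EuclideanSpace ℂ (Fin (n + 1))) 𝓘(ℂ, EuclideanSpace ℂ (Fin n)) ω
      (projExt (n := n)) {v | v ≠ 0} := by
  intro v hv
  refine ContMDiffAt.contMDiffWithinAt ?_
  rw [contMDiffAt_iff_target]
  refine ⟨continuousOn_projExt.continuousAt (isOpen_ne_zero.mem_nhds hv), ?_⟩
  -- This must be the very index chosen in the definition of `chartAt`, so that the preferred chart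
  -- unfolds to `affineCoord i`.
  set i := (exists_mem_affineSource (projExt v)).choose with hi
  have hvi : v i ≠ 0 := by
    have h : projExt v ∈ affineSource i := (exists_mem_affineSource (projExt v)).choose_spec
    rw [projExt_of_ne hv] at h
    exact mk_mem_affineSource.1 h
  have heq : (extChartAt 𝓘(ℂ, EuclideanSpace ℂ (Fin n)) (projExt v) ∘ projExt) =ᶠ[nhds v]
      fun w => (WithLp.toLp 2 fun k : Fin n => w (i.succAbove k) / w i :
        EuclideanSpace ℂ (Fin n)) := by
    filter_upwards [isOpen_ne_zero.mem_nhds hv] with w hw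
    change affineCoord i (projExt w) = _
    rw [projExt_of_ne hw, affineCoord_mk]
  refine ContMDiffAt.congr_of_eventuallyEq (ContDiffAt.contMDiffAt ?_) heq
  rw [contDiffAt_euclidean]
  intro k
  exact ContDiffAt.div (by fun_prop) (by fun_prop) hvi

/-- The section of the projection over the `i`-th affine chart whose `i`-th coordinate is `1`. -/
def affineSection {n : ℕ} (i : Fin (n + 1)) (x : CP n) : EuclideanSpace ℂ (Fin (n + 1)) :=
  WithLp.toLp 2 (i.insertNth (α := fun _ => ℂ) 1 (affineCoord i x).ofLp)

theorem affineSection_ne_zero {n : ℕ} (i : Fin (n + 1)) (x : CP n) : affineSection i x ≠ 0 :=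
  insert_ne_zero i _

theorem mk_affineSection {n : ℕ} {i : Fin (n + 1)} {x : CP n} (hx : x ∈ affineSource i) :
    mk (affineSection i x) (affineSection_ne_zero i x) = x :=
  (affineChart i).left_inv hx

theorem contMDiffOn_affineSection {n : ℕ} (i : Fin (n + 1)) :
    ContMDiffOn 𝓘(ℂ, EuclideanSpace ℂ (Fin n)) 𝓘(ℂ, EuclideanSpace ℂ (Fin (n + 1))) ω
      (affineSection i) (affineSource i) := by
  have h1 : ContMDiffOn 𝓘(ℂ, EuclideanSpace ℂ (Fin n)) 𝓘(ℂ, EuclideanSpace ℂ (Fin n)) ω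
      (affineChart i) (affineSource i) :=
    contMDiffOn_of_mem_maximalAtlas (IsManifold.subset_maximalAtlas ⟨i, rfl⟩)
  have h2 : ContDiff ℂ ω fun w : EuclideanSpace ℂ (Fin n) =>
      (WithLp.toLp 2 (i.insertNth (α := fun _ => ℂ) 1 w.ofLp) :
        EuclideanSpace ℂ (Fin (n + 1))) := by
    rw [contDiff_euclidean]
    intro m
    refine Fin.succAboveCases i ?_ (fun k => ?_) m
    · simpa using contDiff_const
    · simp only [Fin.insertNth_apply_succAbove]
      fun_prop
  exact h2.contMDiff.comp_contMDiffOn h1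

theorem mk_eq_mk_iff_units {n : ℕ} {v w : EuclideanSpace ℂ (Fin (n + 1))} (hv : v ≠ 0)
    (hw : w ≠ 0) : mk v hv = mk w hw ↔ ∃ s : ℂˣ, ∀ i, v i = s * w i := by
  rw [mk_eq_mk_iff]
  constructor
  · rintro ⟨a, rfl⟩
    have ha : a ≠ 0 := by rintro rfl; simp at hv
    exact ⟨Units.mk0 a ha, fun i => rfl⟩
  · rintro ⟨s, hs⟩
    exact ⟨s, by ext i; exact (hs i).symm⟩

end CP

/-! ## The complex quotients -/

/-- The fibres of the projection from `ℂ⁴ ∖ {0}` are the `N_ℂ`-orbits. The affine sections serve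
twice: for the homeomorphism and as holomorphic lifts of its inverse. -/
theorem exists_biholomorphism_tetrahedron : ∃ F : tetrahedron.XΔ ≃ₜ CP 3,
    (∀ z : tetrahedron.openSet, ∃ h : (z : EuclideanSpace ℂ (Fin 4)) ≠ 0,
      F (tetrahedron.projX z) = CP.mk z h) ∧
    IsBiholomorphism tetrahedron.projX 𝓘(ℂ, EuclideanSpace ℂ (Fin 3)) F := by
  have hne : ∀ z ∈ tetrahedron.openSet, z ≠ 0 := fun z hz => by
    rwa [openSet_tetrahedron] at hz
  have hmem : ∀ z, z ≠ 0 → z ∈ tetrahedron.openSet := fun z hz => by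
    rwa [openSet_tetrahedron]
  obtain ⟨F, hF⟩ := exists_homeomorph_of_local_sections tetrahedron.complexSetoid
    (f := fun z => CP.mk z.1 (hne z z.2))
    ((CP.isQuotientMap_proj 3).continuous.comp
      (continuous_subtype_val.subtype_mk fun z => hne z z.2))
    (fun z w => by
      rw [tetrahedron.complexSetoid_iff_exists_comp mem_NC_tetrahedron, CP.mk_eq_mk_iff_units]
      exact ⟨fun ⟨s, h⟩ => ⟨s (), h⟩, fun ⟨s, h⟩ => ⟨fun _ => s, h⟩⟩)
    (fun y => by
      obtain ⟨i, hi⟩ := CP.exists_mem_affineSource y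
      exact ⟨_, CP.affineSection i, CP.isOpen_affineSource i, hi,
        (CP.contMDiffOn_affineSection i).continuousOn,
        fun x hx => ⟨hmem _ (CP.affineSection_ne_zero i x), CP.mk_affineSection hx⟩⟩)
  refine ⟨F, fun z => ⟨hne z z.2, hF z⟩, ?_, ⟨CP.projExt, ?_, fun z => ?_⟩, fun y => ?_⟩
  · rw [openSet_tetrahedron]
    exact CP.isOpen_ne_zero
  · rw [openSet_tetrahedron]
    exact CP.contMDiffOn_projExt
  · exact (CP.projExt_of_ne (hne z z.2)).trans (hF z).symm
  · obtain ⟨i, hi⟩ := CP.exists_mem_affineSource y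
    refine ⟨_, CP.affineSection i, CP.isOpen_affineSource i, hi, CP.contMDiffOn_affineSection i,
      fun x hx => ⟨hmem _ (CP.affineSection_ne_zero i x), ?_⟩⟩
    rw [F.eq_symm_apply]
    exact (hF _).trans (CP.mk_affineSection hx)

/-- The side of the cube on which the `j`-th facet lies. -/
def cubeSide : Fin 6 → Fin 2 := ![0, 1, 0, 1, 0, 1]

/-- The `k`-th of the pairs of coordinates `(z 0, z 1)`, `(z 2, z 3)`, `(z 4, z 5)`. -/
def coordPair (k : Fin 3) (z : EuclideanSpace ℂ (Fin 6)) : EuclideanSpace ℂ (Fin 2) :=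
  !₂[z (![0, 2, 4] k), z (![1, 3, 5] k)]

/-- The vector in `ℂ⁶` with given pairs of coordinates. -/
def ofPairs (w : Fin 3 → EuclideanSpace ℂ (Fin 2)) : EuclideanSpace ℂ (Fin 6) :=
  WithLp.toLp 2 fun j => w (cubeAxis j) (cubeSide j)

theorem coordPair_ofPairs (w : Fin 3 → EuclideanSpace ℂ (Fin 2)) (k : Fin 3) :
    coordPair k (ofPairs w) = w k := by
  ext i
  fin_cases k <;> fin_cases i <;> rfl

theorem coordPair_apply (z : EuclideanSpace ℂ (Fin 6)) (j : Fin 6) :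
    coordPair (cubeAxis j) z (cubeSide j) = z j := by
  fin_cases j <;> rfl

theorem contDiff_coordPair {n : ℕ∞ω}
    (k : Fin 3) : ContDiff ℂ n (coordPair k) := by
  rw [contDiff_euclidean]
  intro i
  fin_cases i <;> simp only [coordPair] <;> simp <;> fun_prop

theorem contDiff_ofPairs {n : ℕ∞ω} :
    ContDiff ℂ n ofPairs := by
  rw [contDiff_euclidean]
  intro j
  simp only [ofPairs]
  fun_prop

theorem mem_openSet_cube {a : ℝ} (ha : 0 < a) {z : EuclideanSpace ℂ (Fin 6)} :
    z ∈ (cube a).openSet ↔ ∀ k, coordPair k z ≠ 0 := by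
  have h : ∀ x y : ℂ, !₂[x, y] ≠ 0 ↔ x ≠ 0 ∨ y ≠ 0 := fun x y => by
    rw [← not_iff_not]
    push Not
    constructor
    · intro h
      exact ⟨congrArg (fun v : EuclideanSpace ℂ (Fin 2) => v 0) h,
        congrArg (fun v : EuclideanSpace ℂ (Fin 2) => v 1) h⟩
    · rintro ⟨rfl, rfl⟩
      ext i
      fin_cases i <;> rfl
  rw [openSet_cube ha]
  simp only [Fin.forall_fin_succ, coordPair, h]
  simp

theorem exists_biholomorphism_cube {a : ℝ} (ha : 0 < a) :
    ∃ F : (cube a).XΔ ≃ₜ CP 1 × CP 1 × CP 1,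
      (∀ z : (cube a).openSet,
        ∃ (h₁ : !₂[(z : EuclideanSpace ℂ (Fin 6)) 0, (z : EuclideanSpace ℂ (Fin 6)) 1] ≠ 0)
          (h₂ : !₂[(z : EuclideanSpace ℂ (Fin 6)) 2, (z : EuclideanSpace ℂ (Fin 6)) 3] ≠ 0)
          (h₃ : !₂[(z : EuclideanSpace ℂ (Fin 6)) 4, (z : EuclideanSpace ℂ (Fin 6)) 5] ≠ 0),
          F ((cube a).projX z) = (CP.mk _ h₁, CP.mk _ h₂, CP.mk _ h₃)) ∧
      IsBiholomorphism (cube a).projX (𝓘(ℂ, EuclideanSpace ℂ (Fin 1)).prod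
        (𝓘(ℂ, EuclideanSpace ℂ (Fin 1)).prod 𝓘(ℂ, EuclideanSpace ℂ (Fin 1)))) F := by
  have hne : ∀ (z : (cube a).openSet) k, coordPair k z ≠ 0 := fun z =>
    (mem_openSet_cube ha).1 z.2
  have hopen : IsOpen (cube a).openSet := by
    have : (cube a).openSet = ⋂ k, coordPair k ⁻¹' {v | v ≠ 0} := by
      ext z; simp [mem_openSet_cube ha]
    rw [this]
    exact isOpen_iInter_of_finite fun k =>
      CP.isOpen_ne_zero.preimage (contDiff_coordPair (n := 0) k).continuous
  set I := 𝓘(ℂ, EuclideanSpace ℂ (Fin 1)) with hI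
  have hproj : ContMDiffOn 𝓘(ℂ, EuclideanSpace ℂ (Fin 6)) (I.prod (I.prod I)) ω
      (fun z => (CP.projExt (coordPair 0 z), CP.projExt (coordPair 1 z),
        CP.projExt (coordPair 2 z))) (cube a).openSet := by
    have h : ∀ k, ContMDiffOn 𝓘(ℂ, EuclideanSpace ℂ (Fin 6)) I ω
        (fun z => CP.projExt (coordPair k z)) (cube a).openSet := fun k =>
      CP.contMDiffOn_projExt.comp (contDiff_coordPair k).contMDiff.contMDiffOn
        fun z hz => (mem_openSet_cube ha).1 hz k
    exact (h 0).prodMk ((h 1).prodMk (h 2))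
  have hsec : ∀ y : CP 1 × CP 1 × CP 1, ∃ (V : Set (CP 1 × CP 1 × CP 1))
      (s : CP 1 × CP 1 × CP 1 → EuclideanSpace ℂ (Fin 6)), IsOpen V ∧ y ∈ V ∧
      ContMDiffOn (I.prod (I.prod I)) 𝓘(ℂ, EuclideanSpace ℂ (Fin 6)) ω s V ∧
      ∀ x ∈ V, s x ∈ (cube a).openSet ∧ (CP.projExt (coordPair 0 (s x)),
        CP.projExt (coordPair 1 (s x)), CP.projExt (coordPair 2 (s x))) = x := by
    intro y
    obtain ⟨i, hi⟩ := CP.exists_mem_affineSource y.1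
    obtain ⟨j, hj⟩ := CP.exists_mem_affineSource y.2.1
    obtain ⟨k, hk⟩ := CP.exists_mem_affineSource y.2.2
    refine ⟨CP.affineSource i ×ˢ CP.affineSource j ×ˢ CP.affineSource k,
      fun x => ofPairs ![CP.affineSection i x.1, CP.affineSection j x.2.1,
        CP.affineSection k x.2.2], (CP.isOpen_affineSource i).prod
        ((CP.isOpen_affineSource j).prod (CP.isOpen_affineSource k)), ⟨hi, hj, hk⟩, ?_,
      fun x hx => ⟨(mem_openSet_cube ha).2 fun m => ?_, ?_⟩⟩
    · refine contDiff_ofPairs.contMDiff.comp_contMDiffOn ?_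
      rw [contMDiffOn_pi_space]
      intro m
      fin_cases m
      · exact (CP.contMDiffOn_affineSection i).comp contMDiff_fst.contMDiffOn fun x hx => hx.1
      · exact (CP.contMDiffOn_affineSection j).comp
          (contMDiff_fst.comp contMDiff_snd).contMDiffOn fun x hx => hx.2.1
      · exact (CP.contMDiffOn_affineSection k).comp
          (contMDiff_snd.comp contMDiff_snd).contMDiffOn fun x hx => hx.2.2
    · rw [coordPair_ofPairs]
      fin_cases m <;> exact CP.affineSection_ne_zero _ _
    · simp only [coordPair_ofPairs]
      refine Prod.ext ?_ (Prod.ext ?_ ?_)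
      · exact (CP.projExt_of_ne (CP.affineSection_ne_zero i _)).trans (CP.mk_affineSection hx.1)
      · exact (CP.projExt_of_ne (CP.affineSection_ne_zero j _)).trans (CP.mk_affineSection hx.2.1)
      · exact (CP.projExt_of_ne (CP.affineSection_ne_zero k _)).trans (CP.mk_affineSection hx.2.2)
  have hmk : ∀ z w : (cube a).openSet, (∀ k, CP.projExt (coordPair k z.1) =
      CP.projExt (coordPair k w.1)) ↔ (cube a).complexSetoid z w := by
    intro z w
    rw [(cube a).complexSetoid_iff_exists_comp (mem_NC_cube a)]
    have h1 : ∀ k, CP.projExt (coordPair k z.1) = CP.projExt (coordPair k w.1) ↔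
        ∃ s : ℂˣ, ∀ i, coordPair k z.1 i = s * coordPair k w.1 i := fun k => by
      rw [CP.projExt_of_ne (hne z k), CP.projExt_of_ne (hne w k), CP.mk_eq_mk_iff_units]
    -- One scalar for each pair of coordinates amounts to one element of `(ℂ^*)³`, which is how
    -- `N_ℂ` acts.
    rw [forall_congr' h1, Classical.skolem]
    refine exists_congr fun s => ⟨fun h j => ?_, fun h k i => ?_⟩
    · rw [← coordPair_apply z.1 j, ← coordPair_apply w.1 j, h]
    · fin_cases k <;> fin_cases i <;> exact h _
  obtain ⟨F, hF⟩ := exists_homeomorph_of_local_sections (cube a).complexSetoid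
    (f := fun z => (CP.projExt (coordPair 0 z.1), CP.projExt (coordPair 1 z.1),
        CP.projExt (coordPair 2 z.1)))
    (continuousOn_iff_continuous_domRestrict.1 hproj.continuousOn)
    (fun z w => by
      rw [← hmk]
      simp [Fin.forall_fin_succ])
    (fun y => by
      obtain ⟨V, s, hV, hy, hs, h⟩ := hsec y
      exact ⟨V, s, hV, hy, hs.continuousOn, fun x hx => ⟨(h x hx).1, (h x hx).2⟩⟩)
  refine ⟨F, fun z => ⟨hne z 0, hne z 1, hne z 2, ?_⟩, hopen, ⟨_, hproj, fun z => (hF z).symm⟩,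
    fun y => ?_⟩
  · refine (hF z).trans ?_
    rw [CP.projExt_of_ne (hne z 0), CP.projExt_of_ne (hne z 1), CP.projExt_of_ne (hne z 2)]
    rfl
  · obtain ⟨V, s, hV, hy, hs, h⟩ := hsec y
    refine ⟨V, s, hV, hy, hs, fun x hx => ⟨(h x hx).1, ?_⟩⟩
    rw [F.eq_symm_apply]
    exact (hF _).trans (h x hx).2

/-! ## Symplectic maps between quotients -/

section Symplectic

variable {E E' : Type*} [NormedAddCommGroup E'] [NormedSpace ℝ E']
  [NormedAddCommGroup E] [NormedSpace ℝ E]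

/-- Equal submanifolds have isomorphic quotients by the same equivalence relation. -/
theorem exists_symplectomorphism_of_eq {P P' : Set E} (h : P = P') (S : Setoid P) (S' : Setoid P')
    (hS : ∀ z w : P, S z w ↔ S' ⟨z, h ▸ z.2⟩ ⟨w, h ▸ w.2⟩) (ω₁ : E → E → E → ℝ) :
    ∃ F : Quotient S ≃ₜ Quotient S',
      (∀ (z : P) (w : P'), (z : E) = w → F (Quotient.mk S z) = Quotient.mk S' w) ∧
      IsSymplectomorphism (Quotient.mk S) (Quotient.mk S') ω₁ ω₁ F := by
  subst h
  obtain rfl : S = S' := Setoid.ext hS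
  have hid : IsSymplecticMap (Quotient.mk S) (Quotient.mk S) ω₁ ω₁ id := fun z =>
    ⟨Set.univ, id, isOpen_univ, trivial, contDiffOn_id, fun x _ => ⟨x.2, rfl⟩,
      fun x _ u _ v _ => by simp⟩
  refine ⟨Homeomorph.refl _, fun z w hzw => ?_, hid, hid⟩
  rw [Subtype.ext hzw]
  rfl

theorem mem_tangentVectors_fderiv {P : Set E} {P' : Set E'} {U : Set E} {h : E → E'} {x u : E}
    (hU : IsOpen U) (hx : x ∈ U) (hh : ContDiffOn ℝ ∞ h U) (hP : ∀ y ∈ P, y ∈ U → h y ∈ P')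
    (hu : u ∈ tangentVectors P x) : fderiv ℝ h x u ∈ tangentVectors P' (h x) := by
  obtain ⟨γ, hγ, hγP, rfl, hd⟩ := hu
  have hc : ContDiffAt ℝ ∞ h (γ 0) := hh.contDiffAt (hU.mem_nhds hx)
  refine ⟨h ∘ γ, hc.comp 0 hγ, ?_, rfl, ?_⟩
  · filter_upwards [hγP, hγ.continuousAt.preimage_mem_nhds (hU.mem_nhds hx)] with t h1 h2
    exact hP _ h1 h2
  · exact (hc.differentiableAt (by simp)).hasFDerivAt.comp_hasDerivAt 0 hd

/-- Two maps that agree on `P` have the same derivatives in the direction of tangent vectors. -/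
theorem fderiv_eq_of_eqOn {P : Set E} {f g : E → E'} {x u : E} (hf : DifferentiableAt ℝ f x)
    (hg : DifferentiableAt ℝ g x) (h : ∀ y ∈ P, f y = g y)
    (hu : u ∈ tangentVectors P x) : fderiv ℝ f x u = fderiv ℝ g x u := by
  obtain ⟨γ, hγ, hγP, rfl, hd⟩ := hu
  have h1 := hf.hasFDerivAt.comp_hasDerivAt 0 hd
  have h2 := hg.hasFDerivAt.comp_hasDerivAt 0 hd
  refine h1.unique (h2.congr_of_eventuallyEq ?_)
  filter_upwards [hγP] with t ht
  exact h _ ht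

/-- The inverse of a symplectic map that is induced by a smooth map `G` with smooth local
sections is symplectic. -/
theorem isSymplecticMap_symm_of_local_sections {M M' : Type*} {P : Set E} {P' : Set E'}
    {p : P → M} {p' : P' → M'} {w : E → E → E → ℝ} {w' : E' → E' → E' → ℝ} (F' : M' → M)
    {G : E → E'} (hG : Differentiable ℝ G)
    (hw : ∀ x ∈ P, ∀ u ∈ tangentVectors P x, ∀ v ∈ tangentVectors P x,
      w x u v = w' (G x) (fderiv ℝ G x u) (fderiv ℝ G x v))
    (hs : ∀ y : P', ∃ (U : Set E') (h : E' → E), IsOpen U ∧ (y : E') ∈ U ∧ ContDiffOn ℝ ∞ h U ∧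
      ∀ x : P', (x : E') ∈ U → G (h x) = x ∧ ∃ hx : h x ∈ P, F' (p' x) = p ⟨h x, hx⟩) :
    IsSymplecticMap p' p w' w F' := by
  intro y
  obtain ⟨U, h, hU, hy, hh, H⟩ := hs y
  refine ⟨U, h, hU, hy, hh, fun x hx => (H x hx).2, ?_⟩
  rintro x ⟨hxP, hxU⟩ u hu v hv
  have hmem : ∀ y ∈ P', y ∈ U → h y ∈ P := fun y hy hyU => (H ⟨y, hy⟩ hyU).2.1
  have hd : DifferentiableAt ℝ h x :=
    (hh.contDiffAt (hU.mem_nhds hxU)).differentiableAt (by simp)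
  -- The identity `G ∘ h = id` holds only on `P'`, so it is differentiated along curves in `P'`. The
  -- invariance `hw` is then applied to the images of `u` and `v` under the derivative of `h`.
  have key : ∀ u ∈ tangentVectors P' x, fderiv ℝ G (h x) (fderiv ℝ h x u) = u := by
    rintro u ⟨γ, hγ, hγP, rfl, hγd⟩
    have h1 := (hG _).hasFDerivAt.comp_hasDerivAt 0 (hd.hasFDerivAt.comp_hasDerivAt 0 hγd)
    refine h1.unique (hγd.congr_of_eventuallyEq ?_)
    filter_upwards [hγP, hγ.continuousAt.preimage_mem_nhds (hU.mem_nhds hxU)] with t h1 h2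
    exact (H ⟨_, h1⟩ h2).1
  rw [hw _ (hmem x hxP hxU) _ (mem_tangentVectors_fderiv hU hxU hh hmem hu) _
    (mem_tangentVectors_fderiv hU hxU hh hmem hv), key u hu, key v hv, (H ⟨x, hxP⟩ hxU).1]

/-- The directional derivative is the linear coefficient in `t`. For the quadratic maps below this
replaces coordinatewise differentiation. -/
theorem fderiv_apply_of_quadratic {f : E → E'} {x u : E} {b c : E'}
    (hf : DifferentiableAt ℝ f x) (h : ∀ t : ℝ, f (x + t • u) = f x + t • b + t ^ 2 • c) :
    fderiv ℝ f x u = b := by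
  rw [← hf.lineDeriv_eq_fderiv, lineDeriv, funext h]
  have h1 : HasDerivAt (fun t : ℝ => f x + t • b + t ^ 2 • c)
      ((1 : ℝ) • b + ((2 : ℕ) * (0 : ℝ) ^ (2 - 1) * 1) • c) 0 :=
    (((hasDerivAt_id (0 : ℝ)).smul_const b).const_add _).add
      (((hasDerivAt_id (0 : ℝ)).pow 2).smul_const c)
  rw [h1.deriv]
  simp

end Symplectic

/-! ## The symplectic quotient of the tetrahedron -/

theorem exists_symplectomorphism_tetrahedron :
    ∃ F : tetrahedron.M ≃ₜ SphereModCircle 4 2,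
      (∀ (z : tetrahedron.levelSet) (w : Metric.sphere (0 : EuclideanSpace ℂ (Fin 4)) 2),
        (z : EuclideanSpace ℂ (Fin 4)) = w → F (tetrahedron.projM z) = projSphere 4 2 w) ∧
      IsSymplectomorphism tetrahedron.projM (projSphere 4 2) omega0 omega0 F := by
  refine exists_symplectomorphism_of_eq levelSet_tetrahedron tetrahedron.symplecticSetoid
    (circleSetoid 4 2) (fun z w => ?_) omega0
  rw [tetrahedron.symplecticSetoid_iff_exists_comp mem_N_tetrahedron]
  constructor
  · rintro ⟨s, h⟩
    exact ⟨s (), by ext j; exact (h j).symm⟩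
  · rintro ⟨s, h⟩
    exact ⟨fun _ => s, fun j => (congrArg (fun v : EuclideanSpace ℂ (Fin 4) => v j) h).symm⟩

/-! ## The Hopf map -/

/-- The Hopf map, taking the sphere of radius `R` in `ℂ²` to the sphere of radius `R` in `ℝ³`. -/
def hopf (R : ℝ) (w : EuclideanSpace ℂ (Fin 2)) : EuclideanSpace ℝ (Fin 3) :=
  !₂[R⁻¹ * (2 * ((w 0).re * (w 1).re + (w 0).im * (w 1).im)),
    R⁻¹ * (2 * ((w 0).im * (w 1).re - (w 0).re * (w 1).im)),
    R⁻¹ * ((w 0).re ^ 2 + (w 0).im ^ 2 - ((w 1).re ^ 2 + (w 1).im ^ 2))]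

/-- The real inner product of `ℂ²`. -/
def realInner (u v : EuclideanSpace ℂ (Fin 2)) : ℝ :=
  (u 0).re * (v 0).re + (u 0).im * (v 0).im + (u 1).re * (v 1).re + (u 1).im * (v 1).im

/-- The imaginary part of the Hermitian form of `ℂ²`. -/
def imInner (u v : EuclideanSpace ℂ (Fin 2)) : ℝ :=
  (u 0).im * (v 0).re - (u 0).re * (v 0).im + (u 1).im * (v 1).re - (u 1).re * (v 1).im

/-- The derivative of the Hopf map at `w` in the direction `u`. -/
def hopfDeriv (R : ℝ) (w u : EuclideanSpace ℂ (Fin 2)) : EuclideanSpace ℝ (Fin 3) :=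
  !₂[R⁻¹ * (2 * ((u 0).re * (w 1).re + (w 0).re * (u 1).re + (u 0).im * (w 1).im
      + (w 0).im * (u 1).im)),
    R⁻¹ * (2 * ((u 0).im * (w 1).re + (w 0).im * (u 1).re - (u 0).re * (w 1).im
      - (w 0).re * (u 1).im)),
    R⁻¹ * (2 * ((w 0).re * (u 0).re + (w 0).im * (u 0).im - (w 1).re * (u 1).re
      - (w 1).im * (u 1).im))]

theorem hopf_add_smul (R t : ℝ) (w u : EuclideanSpace ℂ (Fin 2)) :
    hopf R (w + t • u) = hopf R w + t • hopfDeriv R w u + t ^ 2 • hopf R u := by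
  ext i
  fin_cases i <;> simp [hopf, hopfDeriv] <;> ring

theorem realInner_add_smul (t : ℝ) (w u : EuclideanSpace ℂ (Fin 2)) :
    realInner (w + t • u) (w + t • u) =
      realInner w w + t • (2 * realInner w u) + t ^ 2 • realInner u u := by
  simp [realInner]; ring

theorem contDiff_re_im (i : Fin 2) : ContDiff ℝ ∞ (fun w : EuclideanSpace ℂ (Fin 2) => (w i).re) ∧
    ContDiff ℝ ∞ (fun w : EuclideanSpace ℂ (Fin 2) => (w i).im) := by
  have h : ContDiff ℝ ∞ fun w : EuclideanSpace ℂ (Fin 2) => w i := by fun_prop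
  exact ⟨Complex.reCLM.contDiff.comp h, Complex.imCLM.contDiff.comp h⟩

theorem contDiff_hopf (R : ℝ) : ContDiff ℝ ∞ (hopf R) := by
  obtain ⟨h0, h0'⟩ := contDiff_re_im 0
  obtain ⟨h1, h1'⟩ := contDiff_re_im 1
  rw [contDiff_euclidean]
  intro i
  fin_cases i <;> simp [hopf] <;> fun_prop

theorem contDiff_realInner_self : ContDiff ℝ ∞ fun w => realInner w w := by
  obtain ⟨h0, h0'⟩ := contDiff_re_im 0
  obtain ⟨h1, h1'⟩ := contDiff_re_im 1
  unfold realInner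
  fun_prop

/-- A polynomial identity in the real coordinates. For `u` and `v` orthogonal to `w` only the
multiple of `imInner u v` survives. -/
theorem det_hopfDeriv (R : ℝ) (w u v : EuclideanSpace ℂ (Fin 2)) :
    Matrix.det (Matrix.of ![(hopf R w).ofLp, (hopfDeriv R w u).ofLp, (hopfDeriv R w v).ofLp]) =
      4 * (R⁻¹) ^ 3 * realInner w w * (realInner w w * imInner u v - realInner w u * imInner w v -
        realInner w v * imInner u w) := by
  rw [Matrix.det_fin_three]
  simp [hopf, hopfDeriv, realInner, imInner]
  ring

theorem norm_hopf {R : ℝ} (hR : 0 < R) {w : EuclideanSpace ℂ (Fin 2)}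
    (hw : realInner w w = R ^ 2) : ‖hopf R w‖ = R := by
  rw [EuclideanSpace.norm_eq, Real.sqrt_eq_iff_mul_self_eq (by positivity) hR.le,
    Fin.sum_univ_three]
  simp only [Real.norm_eq_abs, sq_abs]
  -- The remaining identity is `4 |w₀|² |w₁|² + (|w₀|² - |w₁|²)² = (|w₀|² + |w₁|²)²`.
  have h : (R⁻¹) ^ 2 * (realInner w w) ^ 2 = R * R := by rw [hw]; field_simp
  rw [← h]
  simp [hopf, realInner]
  ring

/-- On the sphere of radius `R` in `ℂ²`, the Hopf map pulls back the area form to the form induced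
by the standard symplectic form, up to a factor. -/
theorem areaForm_hopf {R : ℝ} (hR : 0 < R) {w u v : EuclideanSpace ℂ (Fin 2)}
    (hw : realInner w w = R ^ 2) (hu : realInner w u = 0) (hv : realInner w v = 0) :
    areaForm (hopf R w) (hopfDeriv R w u) (hopfDeriv R w v) = 4 * imInner u v := by
  rw [areaForm, det_hopfDeriv, norm_hopf hR hw, hw, hu, hv]
  field_simp
  ring

/-- Two points of the sphere of radius `R` in `ℂ²` have the same image under the Hopf map if and
only if they are in the same orbit of the circle. -/
theorem hopf_eq_iff {R : ℝ} (hR : 0 < R) {w w' : EuclideanSpace ℂ (Fin 2)}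
    (hw : realInner w w = R ^ 2) (hw' : realInner w' w' = R ^ 2) :
    hopf R w = hopf R w' ↔ ∃ s : Circle, ∀ i, w i = s * w' i := by
  have hR' : R⁻¹ ≠ 0 := (inv_pos.2 hR).ne'
  constructor
  · intro h
    have e0 := congrArg (fun p : EuclideanSpace ℝ (Fin 3) => p 0) h
    have e1 := congrArg (fun p : EuclideanSpace ℝ (Fin 3) => p 1) h
    have e2 := congrArg (fun p : EuclideanSpace ℝ (Fin 3) => p 2) h
    simp only [hopf] at e0 e1 e2
    replace e0 := mul_left_cancel₀ hR' e0
    replace e1 := mul_left_cancel₀ hR' e1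
    replace e2 := mul_left_cancel₀ hR' e2
    simp only [realInner] at hw hw'
    -- The height gives the difference of the squared moduli and the radius gives their sum; the
    -- first two Hopf coordinates are the parts of `2 w₀ \bar w₁`, up to the factor `R⁻¹`.
    have n0 : ‖w 0‖ ^ 2 = ‖w' 0‖ ^ 2 := by
      rw [Complex.sq_norm, Complex.sq_norm, Complex.normSq_apply, Complex.normSq_apply]
      linarith
    have n1 : ‖w 1‖ ^ 2 = ‖w' 1‖ ^ 2 := by
      rw [Complex.sq_norm, Complex.sq_norm, Complex.normSq_apply, Complex.normSq_apply]
      linarith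
    rw [sq_eq_sq₀ (norm_nonneg _) (norm_nonneg _)] at n0 n1
    have hm : w 0 * starRingEnd ℂ (w 1) = w' 0 * starRingEnd ℂ (w' 1) := by
      apply Complex.ext <;> simp <;> linarith
    -- The phase is the quotient of the first coordinates, unless they vanish; then the second ones
    -- are nonzero and are used instead.
    by_cases h0 : w' 0 = 0
    · have hw0 : w 0 = 0 := by rw [← norm_eq_zero, n0, h0, norm_zero]
      have h1 : w' 1 ≠ 0 := by
        intro h1
        rw [h0, h1] at hw'
        simp only [Complex.zero_re, Complex.zero_im, mul_zero, add_zero] at hw'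
        exact (pow_pos hR 2).ne hw'
      refine ⟨⟨w 1 / w' 1, ?_⟩, fun i => ?_⟩
      · refine mem_sphere_zero_iff_norm.2 ?_
        rw [norm_div, n1, div_self (norm_ne_zero_iff.2 h1)]
      · fin_cases i
        · simp [h0, hw0]
        · simp [h1]
    · refine ⟨⟨w 0 / w' 0, ?_⟩, fun i => ?_⟩
      · refine mem_sphere_zero_iff_norm.2 ?_
        rw [norm_div, n0, div_self (norm_ne_zero_iff.2 h0)]
      · fin_cases i
        · simp [h0]
        · have hw0 : w 0 ≠ 0 := by rwa [← norm_ne_zero_iff, n0, norm_ne_zero_iff]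
          have h2 : w 1 * starRingEnd ℂ (w 0) = w' 1 * starRingEnd ℂ (w' 0) := by
            have := congrArg (starRingEnd ℂ) hm
            simpa [mul_comm] using this
          have h3 : w 0 * starRingEnd ℂ (w 0) = w' 0 * starRingEnd ℂ (w' 0) := by
            rw [Complex.mul_conj', Complex.mul_conj', n0]
          have h4 : starRingEnd ℂ (w' 0) ≠ 0 := by simpa using h0
          have h5 : starRingEnd ℂ (w 0) ≠ 0 := by simpa using hw0
          change w 1 = w 0 / w' 0 * w' 1
          field_simp
          refine mul_right_cancel₀ h5 ?_
          linear_combination w' 0 * h2 - w' 1 * h3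
  · rintro ⟨s, hs⟩
    have h1 := Circle.normSq_coe s
    rw [Complex.normSq_apply] at h1
    ext i
    fin_cases i <;> simp [hopf, hs] <;> left
    · linear_combination ((w' 0).re * (w' 1).re + (w' 0).im * (w' 1).im) * h1
    · linear_combination ((w' 0).im * (w' 1).re - (w' 0).re * (w' 1).im) * h1
    · linear_combination ((w' 0).re ^ 2 + (w' 0).im ^ 2 - (w' 1).re ^ 2 - (w' 1).im ^ 2) * h1

/-- The Hopf map is equivariant. -/
theorem hopf_mul_exp (R α β : ℝ) {w w' : EuclideanSpace ℂ (Fin 2)}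
    (h0 : w' 0 = Circle.exp α * w 0) (h1 : w' 1 = Circle.exp β * w 1) :
    hopf R w' = rotation (α - β) (hopf R w) := by
  have hα := Real.sin_sq_add_cos_sq α
  have hβ := Real.sin_sq_add_cos_sq β
  have hre : ∀ x : ℝ, (Circle.exp x : ℂ).re = Real.cos x := fun x => by
    rw [Circle.coe_exp, Complex.exp_ofReal_mul_I_re]
  have him : ∀ x : ℝ, (Circle.exp x : ℂ).im = Real.sin x := fun x => by
    rw [Circle.coe_exp, Complex.exp_ofReal_mul_I_im]
  -- The product `w₀ \bar w₁` acquires the factor `e^{i(α - β)}`, and the moduli do not change.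
  ext i
  fin_cases i <;>
    simp only [hopf, rotation, h0, h1, Complex.mul_re, Complex.mul_im, hre, him, Real.cos_sub,
      Real.sin_sub] <;> simp
  · ring
  · ring
  · left
    linear_combination ((w 0).re ^ 2 + (w 0).im ^ 2) * hα - ((w 1).re ^ 2 + (w 1).im ^ 2) * hβ

/-- A section of the Hopf map over the complement of the south pole (for `b = true`) or of the
north pole (for `b = false`). -/
def hopfSection (R : ℝ) (b : Bool) (p : EuclideanSpace ℝ (Fin 3)) : EuclideanSpace ℂ (Fin 2) :=
  if b then
    !₂[((√(R * (R + p 2) / 2) : ℝ) : ℂ), ⟨R * p 0 / (2 * √(R * (R + p 2) / 2)),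
      -(R * p 1 / (2 * √(R * (R + p 2) / 2)))⟩]
  else
    !₂[⟨R * p 0 / (2 * √(R * (R - p 2) / 2)), R * p 1 / (2 * √(R * (R - p 2) / 2))⟩,
      ((√(R * (R - p 2) / 2) : ℝ) : ℂ)]

/-- The domain of the section of the Hopf map. -/
def hopfDomain (R : ℝ) (b : Bool) : Set (EuclideanSpace ℝ (Fin 3)) :=
  if b then {p | 0 < R + p 2} else {p | 0 < R - p 2}

theorem isOpen_hopfDomain (R : ℝ) (b : Bool) : IsOpen (hopfDomain R b) := by
  cases b
  · exact isOpen_lt continuous_const (by fun_prop)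
  · exact isOpen_lt continuous_const (by fun_prop)

theorem exists_mem_hopfDomain {R : ℝ} (hR : 0 < R) (p : EuclideanSpace ℝ (Fin 3)) :
    ∃ b, p ∈ hopfDomain R b := by
  rcases le_or_gt 0 (p 2) with h | h
  · exact ⟨true, show 0 < R + p 2 by linarith⟩
  · exact ⟨false, show 0 < R - p 2 by linarith⟩

theorem contDiffOn_hopfSection {R : ℝ} (hR : 0 < R) (b : Bool) :
    ContDiffOn ℝ ∞ (hopfSection R b) (hopfDomain R b) := by
  have hc : ∀ {f g : EuclideanSpace ℝ (Fin 3) → ℝ} {s : Set (EuclideanSpace ℝ (Fin 3))},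
      ContDiffOn ℝ ∞ f s → ContDiffOn ℝ ∞ g s → ContDiffOn ℝ ∞ (fun p => (⟨f p, g p⟩ : ℂ)) s := by
    intro f g s hf hg
    exact Complex.equivRealProdCLM.symm.contDiff.comp_contDiffOn (hf.prodMk hg)
  cases b
  · have hpos : ∀ p ∈ hopfDomain R false, 0 < R * (R - p 2) / 2 := fun p hp =>
      div_pos (mul_pos hR hp) two_pos
    have hs : ContDiffOn ℝ ∞ (fun p : EuclideanSpace ℝ (Fin 3) => √(R * (R - p 2) / 2))
        (hopfDomain R false) :=
      ContDiffOn.sqrt (by fun_prop) fun p hp => (hpos p hp).ne'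
    have hne : ∀ p ∈ hopfDomain R false, 2 * √(R * (R - p 2) / 2) ≠ 0 := fun p hp =>
      (mul_pos two_pos (Real.sqrt_pos.2 (hpos p hp))).ne'
    refine contDiffOn_piLp' 2 fun i => ?_
    fin_cases i
    · exact hc (ContDiffOn.div (by fun_prop) (contDiffOn_const.mul hs) hne)
        (ContDiffOn.div (by fun_prop) (contDiffOn_const.mul hs) hne)
    · exact Complex.ofRealCLM.contDiff.comp_contDiffOn hs
  · have hpos : ∀ p ∈ hopfDomain R true, 0 < R * (R + p 2) / 2 := fun p hp =>
      div_pos (mul_pos hR hp) two_pos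
    have hs : ContDiffOn ℝ ∞ (fun p : EuclideanSpace ℝ (Fin 3) => √(R * (R + p 2) / 2))
        (hopfDomain R true) :=
      ContDiffOn.sqrt (by fun_prop) fun p hp => (hpos p hp).ne'
    have hne : ∀ p ∈ hopfDomain R true, 2 * √(R * (R + p 2) / 2) ≠ 0 := fun p hp =>
      (mul_pos two_pos (Real.sqrt_pos.2 (hpos p hp))).ne'
    refine contDiffOn_piLp' 2 fun i => ?_
    fin_cases i
    · exact Complex.ofRealCLM.contDiff.comp_contDiffOn hs
    · exact hc (ContDiffOn.div (by fun_prop) (contDiffOn_const.mul hs) hne)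
        (ContDiffOn.div (by fun_prop) (contDiffOn_const.mul hs) hne).neg

theorem hopf_hopfSection {R : ℝ} (hR : 0 < R) {b : Bool} {p : EuclideanSpace ℝ (Fin 3)}
    (hp : ‖p‖ = R) (hb : p ∈ hopfDomain R b) :
    realInner (hopfSection R b p) (hopfSection R b p) = R ^ 2 ∧
      hopf R (hopfSection R b p) = p := by
  have hn : p 0 ^ 2 + p 1 ^ 2 + p 2 ^ 2 = R ^ 2 := by
    rw [← hp, EuclideanSpace.norm_sq_eq, Fin.sum_univ_three]
    simp
  cases b
  · have hpos : 0 < R - p 2 := hb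
    -- A preimage of `p` must have `|w₁|² = R (R - p₂) / 2` and `w₀ \bar w₁ = R (p₀ + i p₁) / 2`.
    -- Taking `w₁ = r > 0` fixes the phase and determines `w₀`.
    obtain ⟨r, hr, hr0⟩ : ∃ r : ℝ, r = √(R * (R - p 2) / 2) ∧ 0 < r :=
      ⟨_, rfl, Real.sqrt_pos.2 (by positivity)⟩
    have hr2 : r ^ 2 = R * (R - p 2) / 2 := by rw [hr, Real.sq_sqrt (by positivity)]
    have hq : (R * p 0 / (2 * r)) ^ 2 + (R * p 1 / (2 * r)) ^ 2 = R * (R + p 2) / 2 := by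
      have : (R * p 0 / (2 * r)) ^ 2 + (R * p 1 / (2 * r)) ^ 2 =
          R ^ 2 * (p 0 ^ 2 + p 1 ^ 2) / (4 * r ^ 2) := by field_simp; ring
      rw [this, hr2, div_eq_iff (by positivity)]
      linear_combination R ^ 2 * hn
    have e : hopfSection R false p = !₂[⟨R * p 0 / (2 * r), R * p 1 / (2 * r)⟩, (r : ℂ)] := by
      rw [hr]; rfl
    rw [e]
    refine ⟨?_, ?_⟩
    · simp [realInner]
      linear_combination hq + hr2
    · ext i
      fin_cases i
      · simp [hopf]; field_simp
      · simp [hopf]; field_simp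
      · simp [hopf]
        rw [hq, hr2]
        field_simp
        ring
  · have hpos : 0 < R + p 2 := hb
    -- Here the phase is fixed by `w₀ = r > 0`; then `w₁` is the conjugate of `R (p₀ + i p₁) / (2
    -- r)`.
    obtain ⟨r, hr, hr0⟩ : ∃ r : ℝ, r = √(R * (R + p 2) / 2) ∧ 0 < r :=
      ⟨_, rfl, Real.sqrt_pos.2 (by positivity)⟩
    have hr2 : r ^ 2 = R * (R + p 2) / 2 := by rw [hr, Real.sq_sqrt (by positivity)]
    have hq : (R * p 0 / (2 * r)) ^ 2 + (R * p 1 / (2 * r)) ^ 2 = R * (R - p 2) / 2 := by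
      have : (R * p 0 / (2 * r)) ^ 2 + (R * p 1 / (2 * r)) ^ 2 =
          R ^ 2 * (p 0 ^ 2 + p 1 ^ 2) / (4 * r ^ 2) := by field_simp; ring
      rw [this, hr2, div_eq_iff (by positivity)]
      linear_combination R ^ 2 * hn
    have e : hopfSection R true p = !₂[(r : ℂ), ⟨R * p 0 / (2 * r), -(R * p 1 / (2 * r))⟩] := by
      rw [hr]; rfl
    rw [e]
    refine ⟨?_, ?_⟩
    · simp [realInner]
      linear_combination hq + hr2
    · ext i
      fin_cases i
      · simp [hopf]; field_simp
      · simp [hopf]; field_simp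
      · simp [hopf]
        rw [hq, hr2]
        field_simp
        ring

/-! ## The symplectic quotient of the cube -/

/-- The product of three Hopf maps. -/
def hopfCube (R : ℝ) (z : EuclideanSpace ℂ (Fin 6)) : Fin 3 → EuclideanSpace ℝ (Fin 3) :=
  fun k => hopf R (coordPair k z)

theorem contDiff_real_coordPair (k : Fin 3) : ContDiff ℝ ∞ (coordPair k) :=
  (contDiff_coordPair k).restrict_scalars ℝ

theorem contDiff_hopfCube (R : ℝ) : ContDiff ℝ ∞ (hopfCube R) :=
  contDiff_pi.2 fun k => (contDiff_hopf R).comp (contDiff_real_coordPair k)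

theorem coordPair_add_smul (k : Fin 3) (t : ℝ) (z u : EuclideanSpace ℂ (Fin 6)) :
    coordPair k (z + t • u) = coordPair k z + t • coordPair k u := by
  ext i
  fin_cases i <;> simp [coordPair]

theorem fderiv_hopfCube (R : ℝ) (z u : EuclideanSpace ℂ (Fin 6)) :
    fderiv ℝ (hopfCube R) z u = fun k => hopfDeriv R (coordPair k z) (coordPair k u) :=
  fderiv_apply_of_quadratic (c := hopfCube R u)
    ((contDiff_hopfCube R).differentiable (by simp) z) fun t => by
      funext k
      simp only [hopfCube, coordPair_add_smul, hopf_add_smul]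
      rfl

theorem realInner_coordPair_self (k : Fin 3) (z : EuclideanSpace ℂ (Fin 6)) :
    realInner (coordPair k z) (coordPair k z) =
      ‖z (![0, 2, 4] k)‖ ^ 2 + ‖z (![1, 3, 5] k)‖ ^ 2 := by
  simp [realInner, coordPair, Complex.sq_norm, Complex.normSq_apply]
  ring

theorem mem_levelSet_cube {a R : ℝ} (hR : R ^ 2 = 2 * a) {z : EuclideanSpace ℂ (Fin 6)} :
    z ∈ (cube a).levelSet ↔ ∀ k, realInner (coordPair k z) (coordPair k z) = R ^ 2 := by
  rw [levelSet_cube, hR]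
  simp [Fin.forall_fin_succ, realInner_coordPair_self]

/-- The squared length of each coordinate pair is constant on the level set, so its derivative along
tangent vectors vanishes. This supplies the orthogonality needed in `areaForm_hopf`. -/
theorem realInner_eq_zero_of_mem_tangentVectors {a : ℝ} {z u : EuclideanSpace ℂ (Fin 6)}
    (hu : u ∈ tangentVectors (cube a).levelSet z) (k : Fin 3) (ha : 0 < a) :
    realInner (coordPair k z) (coordPair k u) = 0 := by
  have hd : Differentiable ℝ fun z => realInner (coordPair k z) (coordPair k z) :=
    (contDiff_realInner_self.comp (contDiff_real_coordPair k)).differentiable (by simp)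
  have hR : √(2 * a) ^ 2 = 2 * a := Real.sq_sqrt (by positivity)
  have h := fderiv_eq_of_eqOn (hd z) (differentiableAt_const (√(2 * a) ^ 2))
    (fun y hy => (mem_levelSet_cube hR).1 hy k) hu
  rw [fderiv_apply_of_quadratic (hd z) fun t => by
    rw [coordPair_add_smul, realInner_add_smul]] at h
  simpa using h

/-- Since `u \bar v - v \bar u = 2i Im(u \bar v)`, the prefactor `1 / 2πi` leaves `1 / π`. -/
theorem omega0_eq_sum_imInner (z u v : EuclideanSpace ℂ (Fin 6)) :
    omega0 z u v = ∑ k, 1 / Real.pi * imInner (coordPair k u) (coordPair k v) := by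
  have h : ∀ x y : ℂ, x * starRingEnd ℂ y - y * starRingEnd ℂ x =
      2 * Complex.I * ((x.im * y.re - x.re * y.im : ℝ) : ℂ) := fun x y => by
    apply Complex.ext <;> simp <;> ring
  have h2 : ∀ s : ℝ, 1 / (2 * Real.pi * Complex.I) * (2 * Complex.I * (s : ℂ)) =
      ((1 / Real.pi * s : ℝ) : ℂ) := fun s => by
    have := Complex.I_ne_zero
    have : (Real.pi : ℂ) ≠ 0 := Complex.ofReal_ne_zero.2 Real.pi_ne_zero
    push_cast
    field_simp
  simp only [omega0, h, ← Finset.mul_sum, ← Complex.ofReal_sum, h2, Complex.ofReal_re]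
  simp [Fin.sum_univ_three, Fin.sum_univ_six, imInner, coordPair]
  ring

theorem omega0_eq_threeSpheresForm {a R : ℝ} (ha : 0 < a) (hR : R = √(2 * a))
    {z u v : EuclideanSpace ℂ (Fin 6)} (hz : z ∈ (cube a).levelSet)
    (hu : u ∈ tangentVectors (cube a).levelSet z) (hv : v ∈ tangentVectors (cube a).levelSet z) :
    omega0 z u v = threeSpheresForm (hopfCube R z) (fderiv ℝ (hopfCube R) z u)
      (fderiv ℝ (hopfCube R) z v) := by
  have hR0 : 0 < R := hR ▸ Real.sqrt_pos.2 (by positivity)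
  have hR2 : R ^ 2 = 2 * a := by rw [hR, Real.sq_sqrt (by positivity)]
  rw [omega0_eq_sum_imInner, threeSpheresForm, fderiv_hopfCube, fderiv_hopfCube]
  refine Finset.sum_congr rfl fun k _ => ?_
  have h := areaForm_hopf hR0 ((mem_levelSet_cube hR2).1 hz k)
    (realInner_eq_zero_of_mem_tangentVectors hu k ha)
    (realInner_eq_zero_of_mem_tangentVectors hv k ha)
  simp only [hopfCube, h]
  field_simp

/-- A section of the product of three Hopf maps. -/
def hopfCubeSection (R : ℝ) (b : Fin 3 → Bool) (p : Fin 3 → EuclideanSpace ℝ (Fin 3)) :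
    EuclideanSpace ℂ (Fin 6) :=
  ofPairs fun k => hopfSection R (b k) (p k)

theorem contDiffOn_hopfCubeSection {R : ℝ} (hR : 0 < R) (b : Fin 3 → Bool) :
    ContDiffOn ℝ ∞ (hopfCubeSection R b) (Set.univ.pi fun k => hopfDomain R (b k)) := by
  refine ((contDiff_ofPairs (n := ∞)).restrict_scalars ℝ).comp_contDiffOn
    (contDiffOn_pi.2 fun k => ?_)
  exact (contDiffOn_hopfSection hR (b k)).comp (contDiff_apply ℝ _ k).contDiffOn
    fun p hp => hp k trivial

theorem hopfCube_hopfCubeSection {a R : ℝ} (hR0 : 0 < R) (hR : R ^ 2 = 2 * a) {b : Fin 3 → Bool}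
    {p : Fin 3 → EuclideanSpace ℝ (Fin 3)} (hp : p ∈ threeSpheres R)
    (hb : p ∈ Set.univ.pi fun k => hopfDomain R (b k)) :
    hopfCubeSection R b p ∈ (cube a).levelSet ∧ hopfCube R (hopfCubeSection R b p) = p := by
  have h := fun k => hopf_hopfSection hR0 (mem_sphere_zero_iff_norm.1 (hp k trivial))
    (hb k trivial)
  refine ⟨(mem_levelSet_cube hR).2 fun k => ?_, funext fun k => ?_⟩
  · rw [hopfCubeSection, coordPair_ofPairs]
    exact (h k).1
  · rw [hopfCube, hopfCubeSection, coordPair_ofPairs]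
    exact (h k).2

/-- On the level set `hopfCube` has the `N`-orbits as fibres and pulls back the form of the spheres
to `ω₀`. Since it is defined on all of `ℂ⁶`, it is a global lift of `F`; the inverse lifts only
locally, by the Hopf sections. -/
theorem exists_symplectomorphism_cube {a : ℝ} (ha : 0 < a) :
    ∃ F : (cube a).M ≃ₜ threeSpheres (√(2 * a)),
      IsSymplectomorphism (cube a).projM id omega0 threeSpheresForm F ∧
      ∀ z : (cube a).levelSet, (F ((cube a).projM z)).1 = hopfCube (√(2 * a)) z.1 := by
  obtain ⟨R, hR⟩ : ∃ R, R = √(2 * a) := ⟨_, rfl⟩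
  have hR0 : 0 < R := hR ▸ Real.sqrt_pos.2 (by positivity)
  have hR2 : R ^ 2 = 2 * a := by rw [hR, Real.sq_sqrt (by positivity)]
  rw [← hR]
  have hmem : ∀ z ∈ (cube a).levelSet, hopfCube R z ∈ threeSpheres R := fun z hz k _ =>
    mem_sphere_zero_iff_norm.2 (norm_hopf hR0 ((mem_levelSet_cube hR2).1 hz k))
  have hdom : ∀ p : Fin 3 → EuclideanSpace ℝ (Fin 3), ∃ b : Fin 3 → Bool,
      p ∈ Set.univ.pi fun k => hopfDomain R (b k) := fun p => by
    choose b hb using fun k => exists_mem_hopfDomain hR0 (p k)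
    exact ⟨b, fun k _ => hb k⟩
  have hopen : ∀ b : Fin 3 → Bool, IsOpen (Set.univ.pi fun k => hopfDomain R (b k)) := fun b =>
    isOpen_set_pi Set.finite_univ fun k _ => isOpen_hopfDomain R (b k)
  obtain ⟨F, hF⟩ := exists_homeomorph_of_local_sections (cube a).symplecticSetoid
    (f := fun z => (⟨hopfCube R z.1, hmem z.1 z.2⟩ : threeSpheres R))
    (((contDiff_hopfCube R).continuous.comp continuous_subtype_val).subtype_mk _)
    (fun z w => by
      rw [(cube a).symplecticSetoid_iff_exists_comp (mem_N_cube a), Subtype.mk.injEq, funext_iff]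
      simp only [hopfCube]
      -- Equality of the three Hopf images gives one phase for each pair of coordinates, that is, an
      -- element of `N`.
      rw [forall_congr' fun k => hopf_eq_iff hR0 ((mem_levelSet_cube hR2).1 z.2 k)
        ((mem_levelSet_cube hR2).1 w.2 k), Classical.skolem]
      refine exists_congr fun s => ⟨fun h k i => ?_, fun h j => ?_⟩
      · fin_cases k <;> fin_cases i <;> exact h _
      · rw [← coordPair_apply z.1 j, ← coordPair_apply w.1 j, h])
    (fun y => by
      obtain ⟨b, hb⟩ := hdom y.1
      refine ⟨_, fun p => hopfCubeSection R b p.1, (hopen b).preimage continuous_subtype_val, hb,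
        (contDiffOn_hopfCubeSection hR0 b).continuousOn.comp continuous_subtype_val.continuousOn
          fun _ h => h, fun x hx => ?_⟩
      have h := hopfCube_hopfCubeSection hR0 hR2 x.2 hx
      exact ⟨h.1, Subtype.ext h.2⟩)
  refine ⟨F, ⟨fun z => ⟨Set.univ, hopfCube R, isOpen_univ, trivial,
    (contDiff_hopfCube R).contDiffOn, fun x _ => ⟨hmem x x.2, hF x⟩,
    fun x hx u hu v hv => omega0_eq_threeSpheresForm ha hR hx.1 hu hv⟩, ?_⟩,
    fun z => congrArg Subtype.val (hF z)⟩
  refine isSymplecticMap_symm_of_local_sections F.symm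
    ((contDiff_hopfCube R).differentiable (by simp))
    (fun x hx u hu v hv => omega0_eq_threeSpheresForm ha hR hx hu hv) fun y => ?_
  obtain ⟨b, hb⟩ := hdom y.1
  refine ⟨_, hopfCubeSection R b, hopen b, hb, contDiffOn_hopfCubeSection hR0 b, fun x hx => ?_⟩
  have h := hopfCube_hopfCubeSection hR0 hR2 x.2 hx
  refine ⟨h.2, h.1, ?_⟩
  rw [F.symm_apply_eq]
  exact Subtype.ext (h.2.symm.trans (congrArg Subtype.val (hF ⟨_, h.1⟩)).symm)

/-- The `k`-th Hopf map sees only the difference of the two angles in the `k`-th pair, which is `2π`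
times the `k`-th coordinate of `π θ`. -/
theorem hopfCube_vadd (a R : ℝ) (θ : Fin 6 → ℝ) (z : EuclideanSpace ℂ (Fin 6)) :
    hopfCube R ((QuotientAddGroup.mk θ : Torus 6) +ᵥ z) = fun k =>
      rotation (2 * Real.pi * (cube a).piR θ k) (hopfCube R z k) := by
  funext k
  have hj : ∀ j, ((QuotientAddGroup.mk θ : Torus 6) +ᵥ z) j =
      Circle.exp (2 * Real.pi * θ j) * z j := fun j => rfl
  have hk : 2 * Real.pi * (cube a).piR θ k =
      2 * Real.pi * θ (![0, 2, 4] k) - 2 * Real.pi * θ (![1, 3, 5] k) := by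
    rw [piR_cube]
    fin_cases k <;> simp [mul_sub]
  rw [hk]
  exact hopf_mul_exp R _ _ (hj _) (hj _)

/-- The rescaled height is half the difference of the squared moduli in a pair. As their sum is
`2a`, pairing with `±e_k` gives one squared modulus minus `a`. -/
theorem dotProduct_hopfCube {a : ℝ} (ha : 0 < a) {z : EuclideanSpace ℂ (Fin 6)}
    (hz : z ∈ (cube a).levelSet) (j : Fin 6) :
    (fun k => √(a / 2) * hopfCube (√(2 * a)) z k 2) ⬝ᵥ (cube a).X j =
      ‖z j‖ ^ 2 + (cube a).lam j := by
  have hsq : √(a / 2) * (√(2 * a))⁻¹ = 1 / 2 := by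
    have h : √(2 * a) = 2 * √(a / 2) := by
      rw [show 2 * a = 2 ^ 2 * (a / 2) by ring, Real.sqrt_mul (by positivity),
        Real.sqrt_sq two_pos.le]
    have h0 : √(a / 2) ≠ 0 := (Real.sqrt_pos.2 (by positivity)).ne'
    rw [h]
    field_simp
  have hk : ∀ k, √(a / 2) * hopfCube (√(2 * a)) z k 2 =
      (‖z (![0, 2, 4] k)‖ ^ 2 - ‖z (![1, 3, 5] k)‖ ^ 2) / 2 := fun k => by
    simp only [Complex.sq_norm, Complex.normSq_apply]
    generalize √(2 * a) = R at hsq ⊢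
    generalize √(a / 2) = κ at hsq ⊢
    simp [hopfCube, hopf, coordPair]
    rw [← mul_assoc, hsq]
    ring
  have hX : (cube a).X = cubeNormal := rfl
  have hl : (cube a).lam j = -a := rfl
  rw [levelSet_cube] at hz
  obtain ⟨h0, h1, h2⟩ := hz
  simp only [hk]
  rw [hX, hl, dotProduct_cubeNormal]
  fin_cases j <;> simp <;> linarith

end Toric

end

theorem mainTheorem1 :
    -- The tetrahedron: the polytope, and the hypotheses of Delzant's theorem.
    ((Toric.tetrahedron.polytope = convexHull ℝ (Set.range Toric.Y) ∧
        Toric.L ≤ Toric.intLattice 3 ∧ Toric.tetrahedron.IsDelzant) ∧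
      -- `N` is the diagonal circle in `T⁴`.
      (∃ e : Additive Circle ≃ₜ+ Toric.tetrahedron.N,
        ∀ s, Toric.expT 4 (e s) = Additive.ofMul fun _ => s.toMul) ∧
      -- `M_Δ = S⁷ / S¹`, where `S⁷` has radius `2`.
      Toric.tetrahedron.levelSet = Metric.sphere (0 : EuclideanSpace ℂ (Fin 4)) 2 ∧
      (∃ F : Toric.tetrahedron.M ≃ₜ Toric.SphereModCircle 4 2,
        (∀ (z : Toric.tetrahedron.levelSet)
          (w : Metric.sphere (0 : EuclideanSpace ℂ (Fin 4)) 2),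
          (z : EuclideanSpace ℂ (Fin 4)) = w →
            F (Toric.tetrahedron.projM z) = Toric.projSphere 4 2 w) ∧
        Toric.IsSymplectomorphism Toric.tetrahedron.projM (Toric.projSphere 4 2)
          Toric.omega0 Toric.omega0 F) ∧
      -- `N_ℂ` is the diagonal `ℂ^*`, and `X_Δ = (ℂ⁴ ∖ {0}) / ℂ^* = ℂP³`.
      (∃ e : Additive ℂˣ ≃ₜ+ Toric.tetrahedron.NC,
        ∀ s, Toric.expTC 4 (e s) = Additive.ofMul fun _ => s.toMul) ∧
      Toric.tetrahedron.openSet = {z | z ≠ 0} ∧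
      (∃ F : Toric.tetrahedron.XΔ ≃ₜ Toric.CP 3,
        (∀ z : Toric.tetrahedron.openSet, ∃ h : (z : EuclideanSpace ℂ (Fin 4)) ≠ 0,
          F (Toric.tetrahedron.projX z) = Toric.CP.mk z h) ∧
        Toric.IsBiholomorphism Toric.tetrahedron.projX 𝓘(ℂ, EuclideanSpace ℂ (Fin 3)) F)) ∧
    -- The cube of side `2a`: the polytope, and the hypotheses of Delzant's theorem.
    (∀ a : ℝ, 0 < a →
      ((Toric.cube a).polytope = convexHull ℝ {v | ∀ i, v i = a ∨ v i = -a} ∧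
        (Toric.cube a).IsDelzant) ∧
      -- `N` is a three-dimensional torus in `T⁶`.
      (∃ e : Additive (Fin 3 → Circle) ≃ₜ+ (Toric.cube a).N,
        ∀ s, Toric.expT 6 (e s) = Additive.ofMul
          ![s.toMul 0, s.toMul 0, s.toMul 1, s.toMul 1, s.toMul 2, s.toMul 2]) ∧
      -- `M_Δ = S² × S² × S²`, as a symplectic toric manifold; the spheres have radius `√(2a)`.
      (Toric.cube a).levelSet = {z | ‖z 0‖ ^ 2 + ‖z 1‖ ^ 2 = 2 * a ∧
        ‖z 2‖ ^ 2 + ‖z 3‖ ^ 2 = 2 * a ∧ ‖z 4‖ ^ 2 + ‖z 5‖ ^ 2 = 2 * a} ∧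
      (∃ F : (Toric.cube a).M ≃ₜ Toric.threeSpheres (Real.sqrt (2 * a)),
        Toric.IsSymplectomorphism (Toric.cube a).projM id
          Toric.omega0 Toric.threeSpheresForm F ∧
        (∀ (θ : Fin 6 → ℝ) (z w : (Toric.cube a).levelSet),
          (w : EuclideanSpace ℂ (Fin 6)) =
              (QuotientAddGroup.mk θ : Toric.Torus 6) +ᵥ (z : EuclideanSpace ℂ (Fin 6)) →
            (F ((Toric.cube a).projM w) : Fin 3 → EuclideanSpace ℝ (Fin 3)) = fun k =>
              Toric.rotation (2 * Real.pi * (Toric.cube a).piR θ k)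
                ((F ((Toric.cube a).projM z) : Fin 3 → EuclideanSpace ℝ (Fin 3)) k)) ∧
        (∀ (z : (Toric.cube a).levelSet) (j : Fin 6),
          (fun k => Real.sqrt (a / 2) *
              (F ((Toric.cube a).projM z) : Fin 3 → EuclideanSpace ℝ (Fin 3)) k 2) ⬝ᵥ
              (Toric.cube a).X j =
            ‖(z : EuclideanSpace ℂ (Fin 6)) j‖ ^ 2 + (Toric.cube a).lam j)) ∧
      -- `N_ℂ` is `(ℂ^*)³`, and `X_Δ = (ℂ² ∖ {0})³ / (ℂ^*)³ = ℂP¹ × ℂP¹ × ℂP¹`.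
      (∃ e : Additive (Fin 3 → ℂˣ) ≃ₜ+ (Toric.cube a).NC,
        ∀ s, Toric.expTC 6 (e s) = Additive.ofMul
          ![s.toMul 0, s.toMul 0, s.toMul 1, s.toMul 1, s.toMul 2, s.toMul 2]) ∧
      (Toric.cube a).openSet =
        {z | (z 0 ≠ 0 ∨ z 1 ≠ 0) ∧ (z 2 ≠ 0 ∨ z 3 ≠ 0) ∧ (z 4 ≠ 0 ∨ z 5 ≠ 0)} ∧
      (∃ F : (Toric.cube a).XΔ ≃ₜ Toric.CP 1 × Toric.CP 1 × Toric.CP 1,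
        (∀ z : (Toric.cube a).openSet,
          ∃ (h₁ : !₂[(z : EuclideanSpace ℂ (Fin 6)) 0, (z : EuclideanSpace ℂ (Fin 6)) 1] ≠ 0)
            (h₂ : !₂[(z : EuclideanSpace ℂ (Fin 6)) 2, (z : EuclideanSpace ℂ (Fin 6)) 3] ≠ 0)
            (h₃ : !₂[(z : EuclideanSpace ℂ (Fin 6)) 4, (z : EuclideanSpace ℂ (Fin 6)) 5] ≠ 0),
            F ((Toric.cube a).projX z) = (Toric.CP.mk _ h₁, Toric.CP.mk _ h₂, Toric.CP.mk _ h₃)) ∧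
        Toric.IsBiholomorphism (Toric.cube a).projX
          (𝓘(ℂ, EuclideanSpace ℂ (Fin 1)).prod
            (𝓘(ℂ, EuclideanSpace ℂ (Fin 1)).prod 𝓘(ℂ, EuclideanSpace ℂ (Fin 1)))) F)) := by
  refine ⟨⟨⟨Toric.polytope_tetrahedron, Toric.L_le_intLattice, Toric.isDelzant_tetrahedron⟩,
    Toric.exists_equiv_N_tetrahedron, Toric.levelSet_tetrahedron,
    Toric.exists_symplectomorphism_tetrahedron, Toric.exists_equiv_NC_tetrahedron,
    Toric.openSet_tetrahedron, Toric.exists_biholomorphism_tetrahedron⟩, fun a ha =>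
    ⟨⟨Toric.polytope_cube ha, Toric.isDelzant_cube ha⟩, Toric.exists_equiv_N_cube a,
    Toric.levelSet_cube a, ?_, Toric.exists_equiv_NC_cube a, Toric.openSet_cube ha,
    Toric.exists_biholomorphism_cube ha⟩⟩
  obtain ⟨F, hF, hFz⟩ := Toric.exists_symplectomorphism_cube ha
  refine ⟨F, hF, fun θ z w hw => ?_, fun z j => ?_⟩
  · rw [hFz, hFz, hw, Toric.hopfCube_vadd a]
  · rw [hFz]
    exact Toric.dotProduct_hopfCube ha z.2 j
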